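/- **Setting.** Let $f:[a,b]\to[a,b]$ be a quasi-quadratic map: $f$ is $C^3$, $f(\{a,b\})\subset\{a,b\}$, $f$ has a unique critical point $c\in(a,b)$ in $(a,b)$, $f''(c)\neq 0$, and $f$ has negative Schwarzian derivative on $(a,b)\setminus\{c\}$. Assume that $c$ is recurrent ($c\in\omega(c)$). Let $I^0=(p,q)\ni c$, $a<p<q<b$, be an open interval such that $f(p)=f(q)$ and $f^t(p)\notin I^0$ for all $t\ge1$ (for example the interval bounded by an orientation-reversing fixed point $\alpha\in(a,b)$ and the other preimage $\alpha'$ of $\alpha$). The principal nest $I^0\supset I^1\supset\dots$ is defined inductively: $I^{n}$ is the component containing $c$ of the domain of the first return map $g_n$ to $I^{n-1}$. The intervals of level $n\ge 1$, denoted $I^n_j$, are the components of the domain of $g_n$ that meet $\mathrm{orb}(c)=\{f^t(c):t\ge 0\}$; $I^n_0=I^n$. Assume that there are no central returns: $g_n(c)\notin I^n$ for all $n\ge1$. Let $\mu_n=|I^n|/|I^{n-1}|$ ($n\ge 1$) be the scaling factors. For an interval $G$ compactly contained in an interval $L$, with $U,V$ the components of $L\setminus G$, let $P(G|L)=\log(1+|G|/|U|)+\log(1+|G|/|V|)$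 be the Poincaré length. The central interval $I^n$ has rank $0$. A non-central interval $I^n_j$ has rank $k\ge1$ if $\mathrm{orb}(c)$ first passes through $I^n_j$ before its first return to $I^{n+k-1}$ but not before its first return to $I^{n+k-2}$. **Lemma 4.6.** (1) If the scaling factors stay away from $0$, i.e. $\inf_{n\ge1}\mu_n>0$, then the ranks of all intervals $I^n_j$ are uniformly bounded: there is an $N$ such that every $I^n_j$, $n\ge1$, has a rank, and this rank is at most $N$. (2) Let $\bar\lambda$ be any number such that $P(I^n|I^{n-1})\le\bar\lambda$ for all $n\ge1$, and put $\bar\sigma=e^{\bar\lambda}/(1+e^{\bar\lambda})<1$. Then there is a constant $C$ such that for every interval $I^n_j$, $n\ge 1$, of rank $k\ge2$ the following hold. There are an open interval $K'\subset I^{n+k-2}\setminus I^{n+k-1}$ which is mapped diffeomorphically onto $I^n_j$ by some iterate of $f$, and an interval $I^{n+k-1}_i$ of level $n+k-1$ whose closure is contained in $K'$, with $$P(I^{n+k-1}_i\,|\,I^{n+k-2})\le P(I^{n+k-1}_i\,|\,K')\le C\bar\sigma^{\,k-1};$$ moreover $\mu_{n+k}\le C\bar\sigma^{(k-1)/2}$.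 -/

import Mathlib

open Set Filter

noncomputable section

namespace PrincipalNest

/-- The Schwarzian derivative `f'''/f' - (3/2) (f''/f')²`. -/
def schwarzian (f : ℝ → ℝ) (x : ℝ) : ℝ :=
  iteratedDeriv 3 f x / deriv f x - 3 / 2 * (iteratedDeriv 2 f x / deriv f x) ^ 2

/-- A quasi-quadratic map of `[a, b]`: a `C³` unimodal map of `[a, b]` into itself that preserves
the boundary, has negative Schwarzian derivative off its unique critical point `c`, and whose
critical point is non-degenerate. -/
structure IsQuasiQuadratic (f : ℝ → ℝ) (a b c : ℝ) : Prop where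
  crit_mem : c ∈ Ioo a b
  mapsTo : MapsTo f (Icc a b) (Icc a b)
  boundary : MapsTo f {a, b} {a, b}
  contDiffOn : ContDiffOn ℝ 3 f (Icc a b)
  deriv_crit : deriv f c = 0
  nondegenerate : iteratedDeriv 2 f c ≠ 0
  deriv_ne : ∀ x ∈ Ioo a b, x ≠ c → deriv f x ≠ 0
  schwarzian_neg : ∀ x ∈ Ioo a b, x ≠ c → schwarzian f x < 0

/-- An initial interval `(p, q) ∋ c`: its endpoints have the same image, and their forward orbits
never enter `(p, q)`. -/
structure IsInitialInterval (f : ℝ → ℝ) (a b c p q : ℝ) : Prop where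
  left_mem : p ∈ Ioo a c
  right_mem : q ∈ Ioo c b
  symmetric : f p = f q
  nice : ∀ t : ℕ, 1 ≤ t → f^[t] p ∉ Ioo p q

/-- The critical point is recurrent: `c ∈ ω(c)`. -/
def IsRecurrent (f : ℝ → ℝ) (c : ℝ) : Prop :=
  MapClusterPt c atTop (fun t : ℕ => f^[t] c)

/-- The points of `T` whose orbits return to `T`: the domain of the first return map to `T`. -/
def returnDomain (f : ℝ → ℝ) (T : Set ℝ) : Set ℝ :=
  {x | x ∈ T ∧ ∃ t : ℕ, 1 ≤ t ∧ f^[t] x ∈ T}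

/-- The principal nest `I⁰ ⊃ I¹ ⊃ …`: `I^{n+1}` is the component around `c` of the domain of the
first return map to `I^n`. -/
def nest (f : ℝ → ℝ) (c : ℝ) (J : Set ℝ) : ℕ → Set ℝ
  | 0 => J
  | n + 1 => connectedComponentIn (returnDomain f (nest f c J n)) c

/-- The intervals `I^n_j` of level `n ≥ 1`: the components of the domain of the first return map to
`I^{n-1}` that meet the orbit of `c`. -/
def levelIntervals (f : ℝ → ℝ) (c : ℝ) (J : Set ℝ) (n : ℕ) : Set (Set ℝ) :=
  {K | ∃ t : ℕ, f^[t] c ∈ returnDomain f (nest f c J (n - 1)) ∧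
    K = connectedComponentIn (returnDomain f (nest f c J (n - 1))) (f^[t] c)}

/-- `t ≥ 1` is the first positive time at which the orbit of `c` is in `A`. -/
def IsFirstPassage (f : ℝ → ℝ) (c : ℝ) (A : Set ℝ) (t : ℕ) : Prop :=
  1 ≤ t ∧ f^[t] c ∈ A ∧ ∀ s : ℕ, 1 ≤ s → s < t → f^[s] c ∉ A

/-- There are no central returns: for every `n ≥ 1` the first return of `c` to `I^{n-1}` does not
lie in `I^n`. -/
def NoCentralReturns (f : ℝ → ℝ) (c : ℝ) (J : Set ℝ) : Prop :=
  ∀ n : ℕ, 1 ≤ n → ∀ t : ℕ,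
    IsFirstPassage f c (nest f c J (n - 1)) t → f^[t] c ∉ nest f c J n

/-- The interval `K` of level `n ≥ 1` has rank `k`. A critical interval has rank `0`; otherwise
`k ≥ 1`, and the orbit of `c` first passes through `K` before its first return to `I^{n+k-1}` but
not before its first return to `I^{n+k-2}`. -/
def HasRank (f : ℝ → ℝ) (c : ℝ) (J : Set ℝ) (n : ℕ) (K : Set ℝ) (k : ℕ) : Prop :=
  (c ∈ K ∧ k = 0) ∨
  (c ∉ K ∧ 1 ≤ k ∧ ∃ l r r' : ℕ, IsFirstPassage f c K l ∧
    IsFirstPassage f c (nest f c J (n + k - 2)) r ∧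
    IsFirstPassage f c (nest f c J (n + k - 1)) r' ∧ r ≤ l ∧ l < r')

/-- The length of a bounded interval. -/
def len (K : Set ℝ) : ℝ := sSup K - sInf K

/-- The scaling factor `μ_n = |I^n| / |I^{n-1}|`, `n ≥ 1`. -/
def scalingFactor (f : ℝ → ℝ) (c : ℝ) (J : Set ℝ) (n : ℕ) : ℝ :=
  len (nest f c J n) / len (nest f c J (n - 1))

/-- The Poincaré length `P(G | L) = log (1 + |G|/|U|) + log (1 + |G|/|V|)` of an interval `G`
compactly contained in an interval `L`, where `U` and `V` are the components of `L \ G`. -/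
def poincareLength (G L : Set ℝ) : ℝ :=
  Real.log (1 + len G / (sInf G - sInf L)) + Real.log (1 + len G / (sSup L - sSup G))

/-- `K'` is a monotone pull-back of `K`: an open interval that `f^m` maps diffeomorphically
onto `K`. -/
def IsMonotonePullback (f : ℝ → ℝ) (m : ℕ) (K' K : Set ℝ) : Prop :=
  IsOpen K' ∧ K'.OrdConnected ∧ BijOn f^[m] K' K ∧ ∀ x ∈ K', deriv f^[m] x ≠ 0

/-- `σ̄ = e^λ̄ / (1 + e^λ̄)`. -/
def sigmaBar (lam : ℝ) : ℝ := Real.exp lam / (1 + Real.exp lam)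

end PrincipalNest

end

namespace PrincipalNest

/-- The exponential of the Poincaré length of the middle interval of four points. -/
noncomputable def crossRatio (w₀ w₁ w₂ w₃ : ℝ) : ℝ :=
  (1 + |w₂ - w₁| / |w₁ - w₀|) * (1 + |w₂ - w₁| / |w₃ - w₂|)

/-- Four points in increasing or in decreasing order. -/
def Ordered (w₀ w₁ w₂ w₃ : ℝ) : Prop :=
  (w₀ < w₁ ∧ w₁ < w₂ ∧ w₂ < w₃) ∨ (w₃ < w₂ ∧ w₂ < w₁ ∧ w₁ < w₀)

lemma convexOn_div_sqrt_deriv {f f₁ f₂ f₃ : ℝ → ℝ} {x y A B : ℝ}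
    (h₁ : ∀ w ∈ Ioo x y, HasDerivAt f (f₁ w) w) (h₂ : ∀ w ∈ Ioo x y, HasDerivAt f₁ (f₂ w) w)
    (h₃ : ∀ w ∈ Ioo x y, HasDerivAt f₂ (f₃ w) w) (hpos : ∀ w ∈ Ioo x y, 0 < f₁ w)
    (hS : ∀ w ∈ Ioo x y, f₃ w / f₁ w - 3 / 2 * (f₂ w / f₁ w) ^ 2 < 0)
    (hq : ∀ w ∈ Ioo x y, 0 < A + B * f w) :
    ConvexOn ℝ (Ioo x y) fun w => (A + B * f w) / √(f₁ w) := by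
  have hs : ∀ w ∈ Ioo x y, HasDerivAt (fun w => √(f₁ w)) (f₂ w / (2 * √(f₁ w))) w :=
    fun w hw => (h₂ w hw).sqrt (hpos w hw).ne'
  have hn : ∀ w ∈ Ioo x y, HasDerivAt (fun w => A + B * f w) (B * f₁ w) w :=
    fun w hw => ((h₁ w hw).const_mul B).const_add A
  have hd1 : ∀ w ∈ Ioo x y, HasDerivAt (fun w => (A + B * f w) / √(f₁ w))
      (B * √(f₁ w) - (A + B * f w) * f₂ w / (2 * f₁ w * √(f₁ w))) w := by
    intro w hw
    have hp := Real.sqrt_pos.2 (hpos w hw)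
    have hsq := Real.sq_sqrt (hpos w hw).le
    refine ((hn w hw).div (hs w hw) hp.ne').congr_deriv ?_
    set s := √(f₁ w)
    rw [← hsq]; field_simp
  have hd2 : ∀ w ∈ Ioo x y, HasDerivAt
      (fun w => B * √(f₁ w) - (A + B * f w) * f₂ w / (2 * f₁ w * √(f₁ w)))
      ((A + B * f w) / √(f₁ w) * (-1 / 2 * (f₃ w / f₁ w - 3 / 2 * (f₂ w / f₁ w) ^ 2))) w := by
    intro w hw
    have hp := Real.sqrt_pos.2 (hpos w hw)
    have hsq := Real.sq_sqrt (hpos w hw).le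
    have hf1 := hpos w hw
    refine (((hs w hw).const_mul B).sub (((hn w hw).mul (h₃ w hw)).div
      (((h₂ w hw).const_mul 2).mul (hs w hw)) (mul_pos (mul_pos two_pos hf1) hp).ne')).congr_deriv ?_
    simp only [Pi.mul_apply]
    set s := √(f₁ w)
    rw [← hsq]; field_simp; ring
  have hint : interior (Ioo x y) = Ioo x y := isOpen_Ioo.interior_eq
  refine convexOn_of_hasDerivWithinAt2_nonneg (convex_Ioo x y)
    (fun w hw => (hd1 w hw).continuousAt.continuousWithinAt)
    (fun w hw => (hd1 w (hint ▸ hw)).hasDerivWithinAt)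
    (fun w hw => (hd2 w (hint ▸ hw)).hasDerivWithinAt) ?_
  intro w hw
  rw [hint] at hw
  have := hS w hw
  have := hq w hw
  have : 0 < -1 / 2 * (f₃ w / f₁ w - 3 / 2 * (f₂ w / f₁ w) ^ 2) := by linarith
  positivity

/-- A function with positive derivative and negative Schwarzian derivative expands cross-ratios. -/
lemma cross_mul_le {f f₁ f₂ f₃ : ℝ → ℝ} {w₀ w₁ w₂ w₃ : ℝ} (hc : ContinuousOn f (Icc w₀ w₃))
    (h₁ : ∀ w ∈ Ioo w₀ w₃, HasDerivAt f (f₁ w) w) (h₂ : ∀ w ∈ Ioo w₀ w₃, HasDerivAt f₁ (f₂ w) w)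
    (h₃ : ∀ w ∈ Ioo w₀ w₃, HasDerivAt f₂ (f₃ w) w) (hpos : ∀ w ∈ Ioo w₀ w₃, 0 < f₁ w)
    (hS : ∀ w ∈ Ioo w₀ w₃, f₃ w / f₁ w - 3 / 2 * (f₂ w / f₁ w) ^ 2 < 0)
    (h01 : w₀ < w₁) (h12 : w₁ < w₂) (h23 : w₂ < w₃) :
    (w₂ - w₀) * (w₃ - w₁) * ((f w₁ - f w₀) * (f w₃ - f w₂)) ≤
      (f w₂ - f w₀) * (f w₃ - f w₁) * ((w₁ - w₀) * (w₃ - w₂)) := by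
  have hmono : StrictMonoOn f (Icc w₀ w₃) := by
    refine strictMonoOn_of_deriv_pos (convex_Icc _ _) hc fun w hw => ?_
    rw [interior_Icc] at hw
    rw [(h₁ w hw).deriv]; exact hpos w hw
  have m0 : w₀ ∈ Icc w₀ w₃ := ⟨le_rfl, by linarith⟩
  have m1 : w₁ ∈ Icc w₀ w₃ := ⟨by linarith, by linarith⟩
  have m2 : w₂ ∈ Icc w₀ w₃ := ⟨by linarith, by linarith⟩
  have m3 : w₃ ∈ Icc w₀ w₃ := ⟨by linarith, le_rfl⟩
  have x01 := hmono m0 m1 h01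
  have x12 := hmono m1 m2 h12
  have x23 := hmono m2 m3 h23
  by_contra! hcon
  set κ : ℝ := (w₁ - w₀) * (f w₃ - f w₁) / ((w₃ - w₁) * (f w₁ - f w₀)) with hκ
  have hκ0 : 0 < κ := by
    apply div_pos <;> apply mul_pos <;> linarith
  set A : ℝ := f w₃ - κ * f w₀ with hA
  have hqe : ∀ w, A + (κ - 1) * f w = (f w₃ - f w) + κ * (f w - f w₀) := fun w => by rw [hA]; ring
  have hq : ∀ w ∈ Icc w₀ w₃, 0 < A + (κ - 1) * f w := by
    intro w hw
    rw [hqe]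
    have h1 := hmono.monotoneOn m0 hw hw.1
    have h2 := hmono.monotoneOn hw m3 hw.2
    rcases h2.lt_or_eq with h | h
    · have := mul_nonneg hκ0.le (sub_nonneg.2 h1); linarith
    · have := mul_pos hκ0 (sub_pos.2 (show f w₀ < f w by linarith)); linarith
  set g : ℝ → ℝ := fun w => (w₀ * (f w₃ - f w) + w₃ * κ * (f w - f w₀)) / (A + (κ - 1) * f w) with hg
  set C : ℝ := κ * (w₃ - w₀) * (f w₃ - f w₀) with hC
  have hC0 : 0 < C := by
    apply mul_pos (mul_pos hκ0 _) <;> linarith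
  have hgd : ∀ w ∈ Ioo w₀ w₃, HasDerivAt g (C * f₁ w / (A + (κ - 1) * f w) ^ 2) w := by
    intro w hw
    have hd := h₁ w hw
    have hqw := hq w (Ioo_subset_Icc_self hw)
    refine (((((hd.const_sub (f w₃)).const_mul w₀).add ((hd.sub_const (f w₀)).const_mul (w₃ * κ))).div
      ((hd.const_mul (κ - 1)).const_add A) hqw.ne')).congr_deriv ?_
    simp only [Pi.add_apply]
    congr 1
    rw [hC, hA]; ring
  have hgc : ContinuousOn g (Icc w₀ w₃) := by
    apply ContinuousOn.div
    · fun_prop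
    · fun_prop
    · exact fun w hw => (hq w hw).ne'
  have g0 : g w₀ = w₀ := by
    have := hq w₀ m0
    simp only [hg]; rw [div_eq_iff this.ne', hA]; ring
  have g3 : g w₃ = w₃ := by
    have := hq w₃ m3
    simp only [hg]; rw [div_eq_iff this.ne', hA]; ring
  have g1 : g w₁ = w₁ := by
    have h := hq w₁ m1
    have e : κ * ((w₃ - w₁) * (f w₁ - f w₀)) = (w₁ - w₀) * (f w₃ - f w₁) := by
      rw [hκ, div_mul_cancel₀]
      exact (mul_pos (by linarith) (by linarith)).ne'
    simp only [hg]; rw [div_eq_iff h.ne', hA]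
    linear_combination e
  have g2 : g w₂ < w₂ := by
    have h := hq w₂ m2
    have e : κ * ((w₃ - w₂) * (f w₂ - f w₀)) < (w₂ - w₀) * (f w₃ - f w₂) := by
      rw [hκ, div_mul_eq_mul_div, div_lt_iff₀ (mul_pos (by linarith) (by linarith))]
      linarith
    simp only [hg]; rw [div_lt_iff₀ h, hA]
    linarith
  have sub : ∀ {s t}, w₀ ≤ s → t ≤ w₃ → Ioo s t ⊆ Ioo w₀ w₃ := fun h h' => Ioo_subset_Ioo h h'
  obtain ⟨a₁, ha₁, e₁⟩ := exists_hasDerivAt_eq_slope g _ h01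
    (hgc.mono (Icc_subset_Icc le_rfl m1.2)) fun w hw => hgd w (sub le_rfl m1.2 hw)
  obtain ⟨a₂, ha₂, e₂⟩ := exists_hasDerivAt_eq_slope g _ h12
    (hgc.mono (Icc_subset_Icc m1.1 m2.2)) fun w hw => hgd w (sub m1.1 m2.2 hw)
  obtain ⟨a₃, ha₃, e₃⟩ := exists_hasDerivAt_eq_slope g _ h23
    (hgc.mono (Icc_subset_Icc m2.1 le_rfl)) fun w hw => hgd w (sub m2.1 le_rfl hw)
  replace ha₁ := And.intro ha₁ (sub le_rfl m1.2 ha₁)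
  replace ha₂ := And.intro ha₂ (sub m1.1 m2.2 ha₂)
  replace ha₃ := And.intro ha₃ (sub m2.1 le_rfl ha₃)
  have hconv := convexOn_div_sqrt_deriv (A := A) (B := κ - 1) h₁ h₂ h₃ hpos hS
    fun w hw => hq w (Ioo_subset_Icc_self hw)
  set Ψ : ℝ → ℝ := fun w => (A + (κ - 1) * f w) / √(f₁ w) with hΨ
  have hΨ0 : ∀ w ∈ Ioo w₀ w₃, 0 < Ψ w := fun w hw =>
    div_pos (hq w (Ioo_subset_Icc_self hw)) (Real.sqrt_pos.2 (hpos w hw))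
  have hΨg : ∀ w ∈ Ioo w₀ w₃, C * f₁ w / (A + (κ - 1) * f w) ^ 2 = C / Ψ w ^ 2 := by
    intro w hw
    have := hq w (Ioo_subset_Icc_self hw)
    have := hpos w hw
    simp only [hΨ, div_pow, Real.sq_sqrt (hpos w hw).le]
    field_simp
  rw [hΨg _ ha₁.2, g0, g1, div_self (by linarith)] at e₁
  rw [hΨg _ ha₂.2, g1] at e₂
  rw [hΨg _ ha₃.2, g3] at e₃
  have p₁ := hΨ0 _ ha₁.2
  have p₂ := hΨ0 _ ha₂.2
  have p₃ := hΨ0 _ ha₃.2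
  have i₂ : C / Ψ a₂ ^ 2 < 1 := by rw [e₂, div_lt_one (by linarith)]; linarith
  have i₃ : 1 < C / Ψ a₃ ^ 2 := by rw [e₃, one_lt_div (by linarith)]; linarith
  rw [div_eq_one_iff_eq (by positivity)] at e₁
  rw [div_lt_one (by positivity)] at i₂
  rw [one_lt_div (by positivity)] at i₃
  have k₁ : Ψ a₁ < Ψ a₂ := lt_of_pow_lt_pow_left₀ 2 p₂.le (by linarith)
  have k₃ : Ψ a₃ < Ψ a₂ := lt_of_pow_lt_pow_left₀ 2 p₂.le (by linarith)
  have := hconv.le_max_of_mem_Icc ha₁.2 ha₃.2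
    (z := a₂) ⟨by linarith [ha₁.1.2, ha₂.1.1], by linarith [ha₂.1.2, ha₃.1.1]⟩
  rcases le_max_iff.1 this with h | h <;> linarith

lemma crossRatio_of_lt {w₀ w₁ w₂ w₃ : ℝ} (h01 : w₀ < w₁) (h12 : w₁ < w₂) (h23 : w₂ < w₃) :
    crossRatio w₀ w₁ w₂ w₃ = (w₂ - w₀) * (w₃ - w₁) / ((w₁ - w₀) * (w₃ - w₂)) := by
  have a := sub_pos.2 h01
  have b := sub_pos.2 h23
  rw [crossRatio, abs_of_pos a, abs_of_pos b, abs_of_pos (sub_pos.2 h12)]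
  field_simp
  ring

lemma crossRatio_reverse (w₀ w₁ w₂ w₃ : ℝ) :
    crossRatio w₃ w₂ w₁ w₀ = crossRatio w₀ w₁ w₂ w₃ := by
  rw [crossRatio, crossRatio, mul_comm, abs_sub_comm w₁ w₂, abs_sub_comm w₀ w₁, abs_sub_comm w₂ w₃]

lemma crossRatio_neg (w₀ w₁ w₂ w₃ : ℝ) :
    crossRatio (-w₀) (-w₁) (-w₂) (-w₃) = crossRatio w₀ w₁ w₂ w₃ := by
  have h : ∀ x y : ℝ, |-x - -y| = |x - y| := fun x y => by rw [← abs_neg]; congr 1; ring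
  simp only [crossRatio, h]

lemma Ordered.reverse {w₀ w₁ w₂ w₃ : ℝ} (h : Ordered w₀ w₁ w₂ w₃) : Ordered w₃ w₂ w₁ w₀ := by
  rcases h with h | h
  · exact Or.inr ⟨h.1, h.2.1, h.2.2⟩
  · exact Or.inl ⟨h.1, h.2.1, h.2.2⟩

lemma crossRatio_le_of_pos {f f₁ f₂ f₃ : ℝ → ℝ} {w₀ w₁ w₂ w₃ : ℝ}
    (hc : ContinuousOn f (Icc w₀ w₃))
    (h₁ : ∀ w ∈ Ioo w₀ w₃, HasDerivAt f (f₁ w) w) (h₂ : ∀ w ∈ Ioo w₀ w₃, HasDerivAt f₁ (f₂ w) w)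
    (h₃ : ∀ w ∈ Ioo w₀ w₃, HasDerivAt f₂ (f₃ w) w) (hpos : ∀ w ∈ Ioo w₀ w₃, 0 < f₁ w)
    (hS : ∀ w ∈ Ioo w₀ w₃, f₃ w / f₁ w - 3 / 2 * (f₂ w / f₁ w) ^ 2 < 0)
    (h01 : w₀ < w₁) (h12 : w₁ < w₂) (h23 : w₂ < w₃) :
    crossRatio w₀ w₁ w₂ w₃ ≤ crossRatio (f w₀) (f w₁) (f w₂) (f w₃) := by
  have hmono : StrictMonoOn f (Icc w₀ w₃) := by
    refine strictMonoOn_of_deriv_pos (convex_Icc _ _) hc fun w hw => ?_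
    rw [interior_Icc] at hw
    rw [(h₁ w hw).deriv]; exact hpos w hw
  have x01 := hmono ⟨le_rfl, by linarith⟩ ⟨by linarith, by linarith⟩ h01
  have x12 := hmono ⟨by linarith, by linarith⟩ ⟨by linarith, by linarith⟩ h12
  have x23 := hmono ⟨by linarith, by linarith⟩ ⟨by linarith, by linarith⟩ h23
  rw [crossRatio_of_lt h01 h12 h23, crossRatio_of_lt x01 x12 x23,
    div_le_div_iff₀ (mul_pos (by linarith) (by linarith)) (mul_pos (by linarith) (by linarith))]
  exact cross_mul_le hc h₁ h₂ h₃ hpos hS h01 h12 h23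

lemma crossRatio_le_of_neg {f f₁ f₂ f₃ : ℝ → ℝ} {w₀ w₁ w₂ w₃ : ℝ}
    (hc : ContinuousOn f (Icc w₀ w₃))
    (h₁ : ∀ w ∈ Ioo w₀ w₃, HasDerivAt f (f₁ w) w) (h₂ : ∀ w ∈ Ioo w₀ w₃, HasDerivAt f₁ (f₂ w) w)
    (h₃ : ∀ w ∈ Ioo w₀ w₃, HasDerivAt f₂ (f₃ w) w) (hneg : ∀ w ∈ Ioo w₀ w₃, f₁ w < 0)
    (hS : ∀ w ∈ Ioo w₀ w₃, f₃ w / f₁ w - 3 / 2 * (f₂ w / f₁ w) ^ 2 < 0)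
    (h01 : w₀ < w₁) (h12 : w₁ < w₂) (h23 : w₂ < w₃) :
    crossRatio w₀ w₁ w₂ w₃ ≤ crossRatio (f w₀) (f w₁) (f w₂) (f w₃) := by
  rw [← crossRatio_neg (f w₀)]
  refine crossRatio_le_of_pos (f := fun w => - f w) hc.neg (fun w hw => (h₁ w hw).neg)
    (fun w hw => (h₂ w hw).neg) (fun w hw => (h₃ w hw).neg)
    (fun w hw => neg_pos.2 (hneg w hw)) (fun w hw => ?_) h01 h12 h23
  simp only [neg_div_neg_eq]
  exact hS w hw


variable {f : ℝ → ℝ} {a b c p q : ℝ}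

namespace IsQuasiQuadratic

lemma contDiffOn_Ioo (hf : IsQuasiQuadratic f a b c) : ContDiffOn ℝ 3 f (Ioo a b) :=
  hf.contDiffOn.mono Ioo_subset_Icc_self

lemma contDiffOn_deriv (hf : IsQuasiQuadratic f a b c) : ContDiffOn ℝ 2 (deriv f) (Ioo a b) :=
  ((contDiffOn_succ_iff_deriv_of_isOpen (n := 2) isOpen_Ioo).1 hf.contDiffOn_Ioo).2.2

lemma contDiffOn_iteratedDeriv_two (hf : IsQuasiQuadratic f a b c) :
    ContDiffOn ℝ 1 (iteratedDeriv 2 f) (Ioo a b) := by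
  rw [iteratedDeriv_succ, iteratedDeriv_one]
  exact ((contDiffOn_succ_iff_deriv_of_isOpen (n := 1) isOpen_Ioo).1 hf.contDiffOn_deriv).2.2

lemma hasDerivAt (hf : IsQuasiQuadratic f a b c) {x : ℝ} (hx : x ∈ Ioo a b) :
    HasDerivAt f (deriv f x) x :=
  ((hf.contDiffOn_Ioo.differentiableOn (by norm_num)).differentiableAt
    (isOpen_Ioo.mem_nhds hx)).hasDerivAt

lemma hasDerivAt_deriv (hf : IsQuasiQuadratic f a b c) {x : ℝ} (hx : x ∈ Ioo a b) :
    HasDerivAt (deriv f) (iteratedDeriv 2 f x) x := by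
  rw [iteratedDeriv_succ, iteratedDeriv_one]
  exact ((hf.contDiffOn_deriv.differentiableOn (by norm_num)).differentiableAt
    (isOpen_Ioo.mem_nhds hx)).hasDerivAt

lemma hasDerivAt_iteratedDeriv_two (hf : IsQuasiQuadratic f a b c) {x : ℝ} (hx : x ∈ Ioo a b) :
    HasDerivAt (iteratedDeriv 2 f) (iteratedDeriv 3 f x) x := by
  rw [iteratedDeriv_succ (n := 2)]
  exact ((hf.contDiffOn_iteratedDeriv_two.differentiableOn (by norm_num)).differentiableAt
    (isOpen_Ioo.mem_nhds hx)).hasDerivAt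

lemma continuousOn (hf : IsQuasiQuadratic f a b c) : ContinuousOn f (Icc a b) :=
  hf.contDiffOn.continuousOn

lemma continuousOn_dslope (hf : IsQuasiQuadratic f a b c) :
    ContinuousOn (dslope (deriv f) c) (Ioo a b) :=
  (_root_.continuousOn_dslope (isOpen_Ioo.mem_nhds hf.crit_mem)).2
    ⟨hf.contDiffOn_deriv.continuousOn, (hf.hasDerivAt_deriv hf.crit_mem).differentiableAt⟩

lemma deriv_eq (hf : IsQuasiQuadratic f a b c) (x : ℝ) :
    deriv f x = (x - c) * dslope (deriv f) c x := by
  have := sub_smul_dslope (deriv f) c x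
  rw [hf.deriv_crit, sub_zero, smul_eq_mul] at this
  exact this.symm

lemma dslope_ne_zero (hf : IsQuasiQuadratic f a b c) {x : ℝ} (hx : x ∈ Ioo a b) :
    dslope (deriv f) c x ≠ 0 := by
  by_cases h : x = c
  · rw [h, dslope_same, (hf.hasDerivAt_deriv hf.crit_mem).deriv]
    exact hf.nondegenerate
  · intro h0
    apply hf.deriv_ne x hx h
    rw [hf.deriv_eq, h0, mul_zero]

lemma exists_sign (hf : IsQuasiQuadratic f a b c) :
    ∃ s : ℝ, (s = 1 ∨ s = -1) ∧ ∀ x ∈ Ioo a b, 0 < s * dslope (deriv f) c x := by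
  by_cases h0 : 0 < dslope (deriv f) c c
  · refine ⟨1, Or.inl rfl, fun x hx => ?_⟩
    by_contra h
    obtain ⟨w, hw, e⟩ := isPreconnected_Ioo.intermediate_value hx hf.crit_mem hf.continuousOn_dslope
      (show (0 : ℝ) ∈ Icc _ _ from ⟨by linarith, h0.le⟩)
    exact hf.dslope_ne_zero hw e
  · refine ⟨-1, Or.inr rfl, fun x hx => ?_⟩
    by_contra h
    obtain ⟨w, hw, e⟩ := isPreconnected_Ioo.intermediate_value hf.crit_mem hx hf.continuousOn_dslope
      (show (0 : ℝ) ∈ Icc _ _ from ⟨by linarith, by linarith⟩)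
    exact hf.dslope_ne_zero hw e

/-- Quasi-quadratic maps are unimodal, and a boundary point is fixed. -/
lemma unimodal (hf : IsQuasiQuadratic f a b c) :
    (StrictMonoOn f (Icc a c) ∧ StrictAntiOn f (Icc c b) ∧ f a = a ∧ f b = a) ∨
    (StrictAntiOn f (Icc a c) ∧ StrictMonoOn f (Icc c b) ∧ f a = b ∧ f b = b) := by
  obtain ⟨s, hs, hD⟩ := hf.exists_sign
  have hc := hf.crit_mem
  have cl : ContinuousOn f (Icc a c) := hf.continuousOn.mono (Icc_subset_Icc le_rfl hc.2.le)
  have cr : ContinuousOn f (Icc c b) := hf.continuousOn.mono (Icc_subset_Icc hc.1.le le_rfl)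
  have ma : a ∈ Icc a b := ⟨le_rfl, by linarith [hc.1, hc.2]⟩
  have mb : b ∈ Icc a b := ⟨by linarith [hc.1, hc.2], le_rfl⟩
  have fc := hf.mapsTo (Ioo_subset_Icc_self hc)
  have fa := hf.boundary (show a ∈ ({a, b} : Set ℝ) by simp)
  have fb := hf.boundary (show b ∈ ({a, b} : Set ℝ) by simp)
  simp only [mem_insert_iff, mem_singleton_iff] at fa fb
  rcases hs with rfl | rfl
  · right
    have h1 : StrictAntiOn f (Icc a c) := by
      refine strictAntiOn_of_deriv_neg (convex_Icc _ _) cl fun x hx => ?_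
      rw [interior_Icc] at hx
      have := hD x ⟨hx.1, hx.2.trans hc.2⟩
      rw [hf.deriv_eq]
      exact mul_neg_of_neg_of_pos (by linarith [hx.2]) (by linarith)
    have h2 : StrictMonoOn f (Icc c b) := by
      refine strictMonoOn_of_deriv_pos (convex_Icc _ _) cr fun x hx => ?_
      rw [interior_Icc] at hx
      have := hD x ⟨hc.1.trans hx.1, hx.2⟩
      rw [hf.deriv_eq]
      exact mul_pos (by linarith [hx.1]) (by linarith)
    have k1 := h1 ⟨le_rfl, hc.1.le⟩ ⟨hc.1.le, le_rfl⟩ hc.1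
    have k2 := h2 ⟨le_rfl, hc.2.le⟩ ⟨hc.2.le, le_rfl⟩ hc.2
    exact ⟨h1, h2, fa.resolve_left (by linarith [fc.1]), fb.resolve_left (by linarith [fc.1])⟩
  · left
    have h1 : StrictMonoOn f (Icc a c) := by
      refine strictMonoOn_of_deriv_pos (convex_Icc _ _) cl fun x hx => ?_
      rw [interior_Icc] at hx
      have := hD x ⟨hx.1, hx.2.trans hc.2⟩
      rw [hf.deriv_eq]
      exact mul_pos_of_neg_of_neg (by linarith [hx.2]) (by linarith)
    have h2 : StrictAntiOn f (Icc c b) := by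
      refine strictAntiOn_of_deriv_neg (convex_Icc _ _) cr fun x hx => ?_
      rw [interior_Icc] at hx
      have := hD x ⟨hc.1.trans hx.1, hx.2⟩
      rw [hf.deriv_eq]
      exact mul_neg_of_pos_of_neg (by linarith [hx.1]) (by linarith)
    have k1 := h1 ⟨le_rfl, hc.1.le⟩ ⟨hc.1.le, le_rfl⟩ hc.1
    have k2 := h2 ⟨le_rfl, hc.2.le⟩ ⟨hc.2.le, le_rfl⟩ hc.2
    exact ⟨h1, h2, fa.resolve_right (by linarith [fc.2]), fb.resolve_right (by linarith [fc.2])⟩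

/-- Near the critical point, the distance to the critical value is comparable to a square. -/
lemma exists_quadratic_bounds (hf : IsQuasiQuadratic f a b c) (hp : p ∈ Ioo a c)
    (hq : q ∈ Ioo c b) :
    ∃ m M : ℝ, 0 < m ∧ 0 < M ∧ ∀ x y : ℝ, (p ≤ x ∧ x ≤ y ∧ y ≤ c) ∨ (c ≤ y ∧ y ≤ x ∧ x ≤ q) →
      m * ((x - c) ^ 2 - (y - c) ^ 2) ≤ |f x - f c| - |f y - f c| ∧
      |f x - f c| - |f y - f c| ≤ M * ((x - c) ^ 2 - (y - c) ^ 2) := by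
  obtain ⟨s, hs, hD⟩ := hf.exists_sign
  have hsub : Icc p q ⊆ Ioo a b := fun x hx => ⟨hp.1.trans_le hx.1, hx.2.trans_lt hq.2⟩
  have hpq : p ≤ q := by linarith [hp.2, hq.1]
  have hDc : ContinuousOn (fun x => s * dslope (deriv f) c x) (Icc p q) :=
    (hf.continuousOn_dslope.mono hsub).const_mul s |>.congr fun x _ => rfl
  obtain ⟨x₀, hx₀, hmin⟩ := isCompact_Icc.exists_isMinOn (nonempty_Icc.2 hpq) hDc
  obtain ⟨x₁, hx₁, hmax⟩ := isCompact_Icc.exists_isMaxOn (nonempty_Icc.2 hpq) hDc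
  set m := s * dslope (deriv f) c x₀
  set M := s * dslope (deriv f) c x₁
  have hm : 0 < m := hD _ (hsub hx₀)
  have hM : 0 < M := hD _ (hsub hx₁)
  have hcpq : c ∈ Icc p q := ⟨hp.2.le, hq.1.le⟩
  set F : ℝ → ℝ := fun x => s * (f x - f c) with hF
  have hFd : ∀ x ∈ Icc p q, HasDerivAt F ((x - c) * (s * dslope (deriv f) c x)) x := by
    intro x hx
    refine (((hf.hasDerivAt (hsub hx)).sub_const (f c)).const_mul s).congr_deriv ?_
    rw [hf.deriv_eq]; ring
  have hG : ∀ k : ℝ, ∀ x ∈ Icc p q, HasDerivAt (fun x => F x - k / 2 * (x - c) ^ 2)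
      ((x - c) * (s * dslope (deriv f) c x - k)) x := by
    intro k x hx
    refine ((hFd x hx).sub ((((hasDerivAt_id x).sub_const c).pow 2).const_mul (k / 2))).congr_deriv ?_
    simp; ring
  have hcont : ∀ k : ℝ, ContinuousOn (fun x => F x - k / 2 * (x - c) ^ 2) (Icc p q) :=
    fun k x hx => (hG k x hx).continuousAt.continuousWithinAt
  have sl : Icc p c ⊆ Icc p q := Icc_subset_Icc le_rfl hq.1.le
  have sr : Icc c q ⊆ Icc p q := Icc_subset_Icc hp.2.le le_rfl
  have mr : MonotoneOn (fun x => F x - m / 2 * (x - c) ^ 2) (Icc c q) := by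
    refine monotoneOn_of_deriv_nonneg (convex_Icc _ _) ((hcont m).mono sr)
      (fun x hx => (hG m x (sr (interior_subset hx))).differentiableAt.differentiableWithinAt)
      fun x hx => ?_
    have hx := interior_subset hx
    rw [(hG m x (sr hx)).deriv]
    exact mul_nonneg (sub_nonneg.2 hx.1) (sub_nonneg.2 (hmin (sr hx)))
  have Mr : AntitoneOn (fun x => F x - M / 2 * (x - c) ^ 2) (Icc c q) := by
    refine antitoneOn_of_deriv_nonpos (convex_Icc _ _) ((hcont M).mono sr)
      (fun x hx => (hG M x (sr (interior_subset hx))).differentiableAt.differentiableWithinAt)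
      fun x hx => ?_
    have hx := interior_subset hx
    rw [(hG M x (sr hx)).deriv]
    exact mul_nonpos_of_nonneg_of_nonpos (sub_nonneg.2 hx.1) (sub_nonpos.2 (hmax (sr hx)))
  have ml : AntitoneOn (fun x => F x - m / 2 * (x - c) ^ 2) (Icc p c) := by
    refine antitoneOn_of_deriv_nonpos (convex_Icc _ _) ((hcont m).mono sl)
      (fun x hx => (hG m x (sl (interior_subset hx))).differentiableAt.differentiableWithinAt)
      fun x hx => ?_
    have hx := interior_subset hx
    rw [(hG m x (sl hx)).deriv]
    exact mul_nonpos_of_nonpos_of_nonneg (sub_nonpos.2 hx.2) (sub_nonneg.2 (hmin (sl hx)))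
  have Ml : MonotoneOn (fun x => F x - M / 2 * (x - c) ^ 2) (Icc p c) := by
    refine monotoneOn_of_deriv_nonneg (convex_Icc _ _) ((hcont M).mono sl)
      (fun x hx => (hG M x (sl (interior_subset hx))).differentiableAt.differentiableWithinAt)
      fun x hx => ?_
    have hx := interior_subset hx
    rw [(hG M x (sl hx)).deriv]
    exact mul_nonneg_of_nonpos_of_nonpos (sub_nonpos.2 hx.2) (sub_nonpos.2 (hmax (sl hx)))
  have hFc : F c = 0 := by simp [hF]
  have habs : ∀ x ∈ Icc p q, |f x - f c| = F x := by
    intro x hx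
    have h0 : 0 ≤ F x := by
      rcases le_total c x with h | h
      · have h1 := mr ⟨le_rfl, hq.1.le⟩ ⟨h, hx.2⟩ h
        have h2 : 0 ≤ m / 2 * (x - c) ^ 2 := by positivity
        simp only [hFc, sub_self] at h1
        linarith
      · have h1 := ml ⟨hx.1, h⟩ ⟨hp.2.le, le_rfl⟩ h
        have h2 : 0 ≤ m / 2 * (x - c) ^ 2 := by positivity
        simp only [hFc, sub_self] at h1
        linarith
    rw [← abs_of_nonneg h0, hF]
    rcases hs with rfl | rfl <;> simp [abs_sub_comm]
  refine ⟨m / 2, M / 2, by positivity, by positivity, fun x y h => ?_⟩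
  rcases h with ⟨h1, h2, h3⟩ | ⟨h1, h2, h3⟩
  · have mx : x ∈ Icc p c := ⟨h1, h2.trans h3⟩
    have my : y ∈ Icc p c := ⟨h1.trans h2, h3⟩
    rw [habs x (sl mx), habs y (sl my)]
    have := ml mx my h2
    have := Ml mx my h2
    simp only at *
    constructor <;> linarith
  · have mx : x ∈ Icc c q := ⟨h1.trans h2, h3⟩
    have my : y ∈ Icc c q := ⟨h1, h2.trans h3⟩
    rw [habs x (sr mx), habs y (sr my)]
    have := mr my mx h2
    have := Mr my mx h2
    simp only at *
    constructor <;> linarith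

/-- `f` expands the cross-ratio of four points on one side of the critical point. -/
lemma crossRatio_le (hf : IsQuasiQuadratic f a b c) {w₀ w₁ w₂ w₃ : ℝ} (ho : Ordered w₀ w₁ w₂ w₃)
    (h : (∀ w ∈ ({w₀, w₃} : Set ℝ), w ∈ Icc a c) ∨ (∀ w ∈ ({w₀, w₃} : Set ℝ), w ∈ Icc c b)) :
    crossRatio w₀ w₁ w₂ w₃ ≤ crossRatio (f w₀) (f w₁) (f w₂) (f w₃) := by
  wlog hlt : w₀ < w₁ ∧ w₁ < w₂ ∧ w₂ < w₃ generalizing w₀ w₁ w₂ w₃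
  · have h' := ho.resolve_left hlt
    rw [← crossRatio_reverse, ← crossRatio_reverse (f w₀)]
    exact this ho.reverse (by rwa [pair_comm]) h'
  obtain ⟨h01, h12, h23⟩ := hlt
  obtain ⟨s, hs, hD⟩ := hf.exists_sign
  have hc := hf.crit_mem
  have hsub : Icc w₀ w₃ ⊆ Icc a b := by
    rcases h with h | h <;> have k0 := h w₀ (by simp) <;> have k3 := h w₃ (by simp) <;>
      exact Icc_subset_Icc (by linarith [k0.1, hc.1]) (by linarith [k3.2, hc.2])
  have hsub' : Ioo w₀ w₃ ⊆ Ioo a b := by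
    rw [← interior_Icc, ← interior_Icc]; exact interior_mono hsub
  have hne : ∀ w ∈ Ioo w₀ w₃, w ≠ c := by
    rintro w hw rfl
    rcases h with h | h <;> have k0 := h w₀ (by simp) <;> have k3 := h w₃ (by simp)
    · linarith [hw.2, k3.2]
    · linarith [hw.1, k0.1]
  have hd : (∀ w ∈ Ioo w₀ w₃, 0 < deriv f w) ∨ (∀ w ∈ Ioo w₀ w₃, deriv f w < 0) := by
    simp only [hf.deriv_eq]
    rcases h with h | h <;> rcases hs with rfl | rfl <;> have k0 := h w₀ (by simp) <;>
      have k3 := h w₃ (by simp)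
    · exact Or.inr fun w hw => mul_neg_of_neg_of_pos (by linarith [hw.2, k3.2])
        (by linarith [hD w (hsub' hw)])
    · exact Or.inl fun w hw => mul_pos_of_neg_of_neg (by linarith [hw.2, k3.2])
        (by linarith [hD w (hsub' hw)])
    · exact Or.inl fun w hw => mul_pos (by linarith [hw.1, k0.1])
        (by linarith [hD w (hsub' hw)])
    · exact Or.inr fun w hw => mul_neg_of_pos_of_neg (by linarith [hw.1, k0.1])
        (by linarith [hD w (hsub' hw)])
  rcases hd with hd | hd
  · exact crossRatio_le_of_pos (hf.continuousOn.mono hsub) (fun w hw => hf.hasDerivAt (hsub' hw))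
      (fun w hw => hf.hasDerivAt_deriv (hsub' hw))
      (fun w hw => hf.hasDerivAt_iteratedDeriv_two (hsub' hw)) hd
      (fun w hw => hf.schwarzian_neg w (hsub' hw) (hne w hw)) h01 h12 h23
  · exact crossRatio_le_of_neg (hf.continuousOn.mono hsub) (fun w hw => hf.hasDerivAt (hsub' hw))
      (fun w hw => hf.hasDerivAt_deriv (hsub' hw))
      (fun w hw => hf.hasDerivAt_iteratedDeriv_two (hsub' hw)) hd
      (fun w hw => hf.schwarzian_neg w (hsub' hw) (hne w hw)) h01 h12 h23

lemma iterate_mem (hf : IsQuasiQuadratic f a b c) (t : ℕ) {x : ℝ} (hx : x ∈ Icc a b) :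
    f^[t] x ∈ Icc a b := hf.mapsTo.iterate t hx

lemma continuousOn_iterate (hf : IsQuasiQuadratic f a b c) (t : ℕ) :
    ContinuousOn f^[t] (Icc a b) := hf.continuousOn.iterate hf.mapsTo t

lemma apply_mem_uIcc (hf : IsQuasiQuadratic f a b c) {z e : ℝ} (hz : z ∈ Icc a b) (he : e ∈ uIcc c z) :
    f e ∈ uIcc (f c) (f z) := by
  have hc := hf.crit_mem
  rcases le_total c z with h | h
  · rw [uIcc_of_le h] at he
    have m1 : c ∈ Icc c b := ⟨le_rfl, hc.2.le⟩
    have m2 : e ∈ Icc c b := ⟨he.1, he.2.trans hz.2⟩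
    have m3 : z ∈ Icc c b := ⟨h, hz.2⟩
    rcases hf.unimodal with ⟨-, k, -⟩ | ⟨-, k, -⟩
    · exact mem_uIcc.2 (Or.inr ⟨k.antitoneOn m2 m3 he.2, k.antitoneOn m1 m2 he.1⟩)
    · exact mem_uIcc.2 (Or.inl ⟨k.monotoneOn m1 m2 he.1, k.monotoneOn m2 m3 he.2⟩)
  · rw [uIcc_of_ge h] at he
    have m1 : c ∈ Icc a c := ⟨hc.1.le, le_rfl⟩
    have m2 : e ∈ Icc a c := ⟨hz.1.trans he.1, he.2⟩
    have m3 : z ∈ Icc a c := ⟨hz.1, h⟩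
    rcases hf.unimodal with ⟨k, -⟩ | ⟨k, -⟩
    · exact mem_uIcc.2 (Or.inr ⟨k.monotoneOn m3 m2 he.1, k.monotoneOn m2 m1 he.2⟩)
    · exact mem_uIcc.2 (Or.inl ⟨k.antitoneOn m2 m1 he.2, k.antitoneOn m3 m2 he.1⟩)

end IsQuasiQuadratic

lemma exists_preimage_of_strictMonoOn {g : ℝ → ℝ} {A B α β z : ℝ} (hg : StrictMonoOn g (Icc A B))
    (hc : ContinuousOn g (Icc A B)) (hz : z ∈ Icc A B) (hgz : g z ∈ Ioo α β) (hA : g A ≤ α)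
    (hB : β ≤ g B) : ∃ x ∈ Icc A B, ∃ y ∈ Icc A B, z ∈ Ioo x y ∧ g x = α ∧ g y = β := by
  have hAB := hz.1.trans hz.2
  obtain ⟨x, hx, ex⟩ := intermediate_value_Icc hAB hc
    (show α ∈ Icc _ _ from ⟨hA, by linarith [hgz.1, hgz.2]⟩)
  obtain ⟨y, hy, ey⟩ := intermediate_value_Icc hAB hc
    (show β ∈ Icc _ _ from ⟨by linarith [hgz.1, hgz.2], hB⟩)
  exact ⟨x, hx, y, hy, ⟨(hg.lt_iff_lt hx hz).1 (ex ▸ hgz.1), (hg.lt_iff_lt hz hy).1 (ey ▸ hgz.2)⟩,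
    ex, ey⟩

lemma exists_preimage_of_strictAntiOn {g : ℝ → ℝ} {A B α β z : ℝ} (hg : StrictAntiOn g (Icc A B))
    (hc : ContinuousOn g (Icc A B)) (hz : z ∈ Icc A B) (hgz : g z ∈ Ioo α β) (hA : β ≤ g A)
    (hB : g B ≤ α) : ∃ x ∈ Icc A B, ∃ y ∈ Icc A B, z ∈ Ioo x y ∧ g x = β ∧ g y = α := by
  obtain ⟨x, hx, y, hy, hm, ex, ey⟩ := exists_preimage_of_strictMonoOn (g := fun w => - g w)
    (α := -β) (β := -α) hg.neg hc.neg hz ⟨by linarith [hgz.2], by linarith [hgz.1]⟩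
    (by linarith) (by linarith)
  exact ⟨x, hx, y, hy, hm, by linarith, by linarith⟩

namespace IsQuasiQuadratic

/-- Pull-back of an interval without critical values. -/
lemma exists_pullback (hf : IsQuasiQuadratic f a b c) {z α β : ℝ} (hz : z ∈ Icc a b)
    (hfz : f z ∈ Ioo α β) (hαβ : Icc α β ⊆ Ioo a b) (hfc : f c ∉ Ioo α β) :
    ∃ x y, z ∈ Ioo x y ∧ Icc x y ⊆ Ioo a b ∧ c ∉ Ioo x y ∧
      ((f x = α ∧ f y = β) ∨ (f x = β ∧ f y = α)) := by
  have hc := hf.crit_mem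
  have hlt : α < β := hfz.1.trans hfz.2
  have hα := hαβ ⟨le_rfl, hlt.le⟩
  have hβ := hαβ ⟨hlt.le, le_rfl⟩
  have cl : ContinuousOn f (Icc a c) := hf.continuousOn.mono (Icc_subset_Icc le_rfl hc.2.le)
  have cr : ContinuousOn f (Icc c b) := hf.continuousOn.mono (Icc_subset_Icc hc.1.le le_rfl)
  have hbd : ∀ w ∈ ({a, b} : Set ℝ), f w ≠ α ∧ f w ≠ β := by
    intro w hw
    have h := hf.boundary hw
    simp only [mem_insert_iff, mem_singleton_iff] at h
    rcases h with h | h <;> rw [h] <;> constructor <;> intro h' <;>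
      linarith [hα.1, hα.2, hβ.1, hβ.2]
  have fin : ∀ x y : ℝ, x ∈ Icc a b → y ∈ Icc a b →
      ((f x = α ∧ f y = β) ∨ (f x = β ∧ f y = α)) → Icc x y ⊆ Ioo a b := by
    intro x y hx hy h
    have hxa : x ≠ a := by
      rintro rfl
      have := hbd x (by simp)
      tauto
    have hyb : y ≠ b := by
      rintro rfl
      have := hbd y (by simp)
      tauto
    exact Icc_subset_Ioo (lt_of_le_of_ne hx.1 hxa.symm) (lt_of_le_of_ne hy.2 hyb)
  have sl : Icc a c ⊆ Icc a b := Icc_subset_Icc le_rfl hc.2.le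
  have sr : Icc c b ⊆ Icc a b := Icc_subset_Icc hc.1.le le_rfl
  have out : f c ≤ α ∨ β ≤ f c := by
    by_contra! h
    exact hfc ⟨h.1, h.2⟩
  rcases le_total z c with h | h
  · have mz : z ∈ Icc a c := ⟨hz.1, h⟩
    have mc : c ∈ Icc a c := ⟨hc.1.le, le_rfl⟩
    rcases hf.unimodal with ⟨k, -, e, -⟩ | ⟨k, -, e, -⟩
    · have := k.monotoneOn mz mc h
      obtain ⟨x, hx, y, hy, hm, e⟩ := exists_preimage_of_strictMonoOn k cl mz hfz
        (by linarith [hα.1]) (out.resolve_left (by linarith [hfz.1]))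
      exact ⟨x, y, hm, fin x y (sl hx) (sl hy) (Or.inl e), fun h => by linarith [h.2, hy.2],
        Or.inl e⟩
    · have := k.antitoneOn mz mc h
      obtain ⟨x, hx, y, hy, hm, e⟩ := exists_preimage_of_strictAntiOn k cl mz hfz
        (by linarith [hβ.2]) (out.resolve_right (by linarith [hfz.2]))
      exact ⟨x, y, hm, fin x y (sl hx) (sl hy) (Or.inr e), fun h => by linarith [h.2, hy.2],
        Or.inr e⟩
  · have mz : z ∈ Icc c b := ⟨h, hz.2⟩
    have mc : c ∈ Icc c b := ⟨le_rfl, hc.2.le⟩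
    rcases hf.unimodal with ⟨-, k, -, e⟩ | ⟨-, k, -, e⟩
    · have := k.antitoneOn mc mz h
      obtain ⟨x, hx, y, hy, hm, e⟩ := exists_preimage_of_strictAntiOn k cr mz hfz
        (out.resolve_left (by linarith [hfz.1])) (by linarith [hα.1])
      exact ⟨x, y, hm, fin x y (sr hx) (sr hy) (Or.inr e), fun h => by linarith [h.1, hx.1],
        Or.inr e⟩
    · have := k.monotoneOn mc mz h
      obtain ⟨x, hx, y, hy, hm, e⟩ := exists_preimage_of_strictMonoOn k cr mz hfz
        (out.resolve_right (by linarith [hfz.2])) (by linarith [hβ.2])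
      exact ⟨x, y, hm, fin x y (sr hx) (sr hy) (Or.inl e), fun h => by linarith [h.1, hx.1],
        Or.inl e⟩

/-- Pull-back of an interval around the critical value. -/
lemma exists_critical_pullback (hf : IsQuasiQuadratic f a b c) {α β : ℝ}
    (hαβ : Icc α β ⊆ Ioo a b) (hfc : f c ∈ Ioo α β) :
    ∃ l ∈ Ioo a c, ∃ u ∈ Ioo c b, f l = f u ∧ (f l = α ∨ f l = β) ∧
      ∀ z ∈ Ioo l u, f z ∈ Ioo α β := by
  have hc := hf.crit_mem
  have hlt : α < β := hfc.1.trans hfc.2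
  have hα := hαβ ⟨le_rfl, hlt.le⟩
  have hβ := hαβ ⟨hlt.le, le_rfl⟩
  have cl : ContinuousOn f (Icc a c) := hf.continuousOn.mono (Icc_subset_Icc le_rfl hc.2.le)
  have cr : ContinuousOn f (Icc c b) := hf.continuousOn.mono (Icc_subset_Icc hc.1.le le_rfl)
  have mcl : c ∈ Icc a c := ⟨hc.1.le, le_rfl⟩
  have mcr : c ∈ Icc c b := ⟨le_rfl, hc.2.le⟩
  rcases hf.unimodal with ⟨k1, k2, ea, eb⟩ | ⟨k1, k2, ea, eb⟩
  · obtain ⟨l, hl, el⟩ := intermediate_value_Ioo hc.1.le cl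
      (show α ∈ Ioo _ _ from ⟨by rw [ea]; exact hα.1, hfc.1⟩)
    obtain ⟨u, hu, eu⟩ := intermediate_value_Ioo' hc.2.le cr
      (show α ∈ Ioo _ _ from ⟨by rw [eb]; exact hα.1, hfc.1⟩)
    refine ⟨l, hl, u, hu, el.trans eu.symm, Or.inl el, fun z hz => ?_⟩
    rcases le_total z c with h | h
    · have mz : z ∈ Icc a c := ⟨(hl.1.trans hz.1).le, h⟩
      have h1 := k1 (Ioo_subset_Icc_self hl) mz hz.1
      have h2 := k1.monotoneOn mz mcl h
      exact ⟨by linarith, by linarith [hfc.2]⟩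
    · have mz : z ∈ Icc c b := ⟨h, (hz.2.trans hu.2).le⟩
      have h1 := k2 mz (Ioo_subset_Icc_self hu) hz.2
      have h2 := k2.antitoneOn mcr mz h
      exact ⟨by linarith, by linarith [hfc.2]⟩
  · obtain ⟨l, hl, el⟩ := intermediate_value_Ioo' hc.1.le cl
      (show β ∈ Ioo _ _ from ⟨hfc.2, by rw [ea]; exact hβ.2⟩)
    obtain ⟨u, hu, eu⟩ := intermediate_value_Ioo hc.2.le cr
      (show β ∈ Ioo _ _ from ⟨hfc.2, by rw [eb]; exact hβ.2⟩)
    refine ⟨l, hl, u, hu, el.trans eu.symm, Or.inr el, fun z hz => ?_⟩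
    rcases le_total z c with h | h
    · have mz : z ∈ Icc a c := ⟨(hl.1.trans hz.1).le, h⟩
      have h1 := k1 (Ioo_subset_Icc_self hl) mz hz.1
      have h2 := k1.antitoneOn mz mcl h
      exact ⟨by linarith [hfc.1], by linarith⟩
    · have mz : z ∈ Icc c b := ⟨h, (hz.2.trans hu.2).le⟩
      have h1 := k2 mz (Ioo_subset_Icc_self hu) hz.2
      have h2 := k2.monotoneOn mcr mz h
      exact ⟨by linarith [hfc.1], by linarith⟩

end IsQuasiQuadratic

/-- `f^t` maps `[x, y]` monotonically onto `[α, β]`, and `(x, y)` avoids the critical points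
of `f^t`. -/
structure IsBranch (f : ℝ → ℝ) (a b c : ℝ) (t : ℕ) (x y α β : ℝ) : Prop where
  lt : x < y
  lt_image : α < β
  subset : Icc x y ⊆ Ioo a b
  noncritical : ∀ i < t, ∀ w ∈ Ioo x y, f^[i] w ≠ c
  ends : (f^[t] x = α ∧ f^[t] y = β) ∨ (f^[t] x = β ∧ f^[t] y = α)

namespace IsBranch

variable {t : ℕ} {x y α β : ℝ}

lemma subset_Icc (h : IsBranch f a b c t x y α β) : Icc x y ⊆ Icc a b :=
  h.subset.trans Ioo_subset_Icc_self

lemma side (h : IsBranch f a b c t x y α β) (hf : IsQuasiQuadratic f a b c) {i : ℕ} (hi : i < t) :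
    (∀ w ∈ Icc x y, f^[i] w ∈ Icc a c) ∨ (∀ w ∈ Icc x y, f^[i] w ∈ Icc c b) := by
  have hcont : ContinuousOn f^[i] (Icc x y) := (hf.continuousOn_iterate i).mono h.subset_Icc
  have hpre : IsPreconnected (f^[i] '' Ioo x y) :=
    isPreconnected_Ioo.image _ (hcont.mono Ioo_subset_Icc_self)
  have key : (∀ w ∈ Ioo x y, f^[i] w ≤ c) ∨ (∀ w ∈ Ioo x y, c ≤ f^[i] w) := by
    by_contra! hcon
    obtain ⟨⟨w, hw, h1⟩, w', hw', h2⟩ := hcon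
    obtain ⟨v, hv, e⟩ := hpre.ordConnected.out (mem_image_of_mem _ hw') (mem_image_of_mem _ hw)
      ⟨h2.le, h1.le⟩
    exact h.noncritical i hi v hv e
  rw [← closure_Ioo h.lt.ne] at hcont ⊢
  rcases key with k | k
  · left
    intro w hw
    have hw' := hw
    rw [closure_Ioo h.lt.ne] at hw'
    exact ⟨(hf.iterate_mem i (h.subset_Icc hw')).1,
      closure_minimal (s := f^[i] '' Ioo x y) (by rintro _ ⟨v, hv, rfl⟩; exact k v hv)
        isClosed_Iic (hcont.image_closure (mem_image_of_mem _ hw))⟩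
  · right
    intro w hw
    have hw' := hw
    rw [closure_Ioo h.lt.ne] at hw'
    exact ⟨closure_minimal (s := f^[i] '' Ioo x y) (by rintro _ ⟨v, hv, rfl⟩; exact k v hv)
        isClosed_Ici (hcont.image_closure (mem_image_of_mem _ hw)),
        (hf.iterate_mem i (h.subset_Icc hw')).2⟩

lemma strict_iterate (h : IsBranch f a b c t x y α β) (hf : IsQuasiQuadratic f a b c) {i : ℕ}
    (hi : i ≤ t) : StrictMonoOn f^[i] (Icc x y) ∨ StrictAntiOn f^[i] (Icc x y) := by
  induction i with
  | zero => exact Or.inl (strictMono_id.strictMonoOn _)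
  | succ i ih =>
    rw [Function.iterate_succ']
    rcases h.side hf (Nat.lt_of_succ_le hi) with s | s <;>
      rcases ih (Nat.le_of_succ_le hi) with m | m <;>
      rcases hf.unimodal with ⟨k1, k2, -⟩ | ⟨k1, k2, -⟩
    · exact Or.inl (k1.comp m s)
    · exact Or.inr (k1.comp_strictMonoOn m s)
    · exact Or.inr (k1.comp_strictAntiOn m s)
    · exact Or.inl (k1.comp m s)
    · exact Or.inr (k2.comp_strictMonoOn m s)
    · exact Or.inl (k2.comp m s)
    · exact Or.inl (k2.comp m s)
    · exact Or.inr (k2.comp_strictAntiOn m s)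

lemma strict (h : IsBranch f a b c t x y α β) (hf : IsQuasiQuadratic f a b c) :
    (StrictMonoOn f^[t] (Icc x y) ∧ f^[t] x = α ∧ f^[t] y = β) ∨
    (StrictAntiOn f^[t] (Icc x y) ∧ f^[t] x = β ∧ f^[t] y = α) := by
  have hx : x ∈ Icc x y := ⟨le_rfl, h.lt.le⟩
  have hy : y ∈ Icc x y := ⟨h.lt.le, le_rfl⟩
  have := h.lt_image
  rcases h.strict_iterate hf le_rfl with m | m
  · have := m hx hy h.lt
    exact Or.inl ⟨m, h.ends.resolve_right (by rintro ⟨e1, e2⟩; linarith)⟩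
  · have := m hx hy h.lt
    exact Or.inr ⟨m, h.ends.resolve_left (by rintro ⟨e1, e2⟩; linarith)⟩

lemma mapsTo (h : IsBranch f a b c t x y α β) (hf : IsQuasiQuadratic f a b c) :
    MapsTo f^[t] (Ioo x y) (Ioo α β) := by
  have hx : x ∈ Icc x y := ⟨le_rfl, h.lt.le⟩
  have hy : y ∈ Icc x y := ⟨h.lt.le, le_rfl⟩
  intro w hw
  have hw' := Ioo_subset_Icc_self hw
  rcases h.strict hf with ⟨m, rfl, rfl⟩ | ⟨m, rfl, rfl⟩
  · exact ⟨m hx hw' hw.1, m hw' hy hw.2⟩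
  · exact ⟨m hw' hy hw.2, m hx hw' hw.1⟩

lemma bijOn (h : IsBranch f a b c t x y α β) (hf : IsQuasiQuadratic f a b c) :
    BijOn f^[t] (Ioo x y) (Ioo α β) := by
  have hcont : ContinuousOn f^[t] (Icc x y) := (hf.continuousOn_iterate t).mono h.subset_Icc
  refine ⟨h.mapsTo hf, ?_, ?_⟩
  · rcases h.strict_iterate hf le_rfl with m | m
    · exact m.injOn.mono Ioo_subset_Icc_self
    · exact m.injOn.mono Ioo_subset_Icc_self
  · rcases h.ends with ⟨rfl, rfl⟩ | ⟨rfl, rfl⟩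
    · exact intermediate_value_Ioo h.lt.le hcont
    · exact intermediate_value_Ioo' h.lt.le hcont

lemma deriv_ne_zero (h : IsBranch f a b c t x y α β) (hf : IsQuasiQuadratic f a b c) {w : ℝ}
    (hw : w ∈ Ioo x y) (hαβ : Icc α β ⊆ Ioo a b) : deriv f^[t] w ≠ 0 := by
  have hint : ∀ i ≤ t, f^[i] w ∈ Ioo a b := by
    intro i hi
    have h1 := hf.iterate_mem i (h.subset_Icc (Ioo_subset_Icc_self hw))
    by_contra hcon
    have hb : f^[i] w ∈ ({a, b} : Set ℝ) := by
      simp only [mem_insert_iff, mem_singleton_iff]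
      by_contra! h'
      exact hcon ⟨lt_of_le_of_ne h1.1 h'.1.symm, lt_of_le_of_ne h1.2 h'.2⟩
    have hb' := hf.boundary.iterate (t - i) hb
    rw [← Function.iterate_add_apply, Nat.sub_add_cancel hi] at hb'
    have h2 := hαβ (Ioo_subset_Icc_self (h.mapsTo hf hw))
    simp only [mem_insert_iff, mem_singleton_iff] at hb'
    rcases hb' with e | e <;> linarith [h2.1, h2.2]
  have key : ∀ i ≤ t, ∃ d, d ≠ 0 ∧ HasDerivAt f^[i] d w := by
    intro i
    induction i with
    | zero => exact fun _ => ⟨1, one_ne_zero, hasDerivAt_id w⟩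
    | succ i ih =>
      intro hi
      obtain ⟨d, hd, hd'⟩ := ih (Nat.le_of_succ_le hi)
      have hi' := hint i (Nat.le_of_succ_le hi)
      rw [Function.iterate_succ']
      exact ⟨_, mul_ne_zero (hf.deriv_ne _ hi' (h.noncritical i (Nat.lt_of_succ_le hi) w hw)) hd,
        (hf.hasDerivAt hi').comp w hd'⟩
  obtain ⟨d, hd, hd'⟩ := key t le_rfl
  rwa [hd'.deriv]

/-- Branches expand cross-ratios. -/
lemma crossRatio_le (h : IsBranch f a b c t x y α β) (hf : IsQuasiQuadratic f a b c)
    {w₀ w₁ w₂ w₃ : ℝ} (ho : Ordered w₀ w₁ w₂ w₃) (h₀ : w₀ ∈ Icc x y) (h₃ : w₃ ∈ Icc x y) :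
    crossRatio w₀ w₁ w₂ w₃ ≤ crossRatio (f^[t] w₀) (f^[t] w₁) (f^[t] w₂) (f^[t] w₃) := by
  have h₁ : w₁ ∈ Icc x y := by
    rcases ho with ⟨i, j, k⟩ | ⟨i, j, k⟩ <;> constructor <;> linarith [h₀.1, h₀.2, h₃.1, h₃.2]
  have h₂ : w₂ ∈ Icc x y := by
    rcases ho with ⟨i, j, k⟩ | ⟨i, j, k⟩ <;> constructor <;> linarith [h₀.1, h₀.2, h₃.1, h₃.2]
  have key : ∀ i ≤ t, Ordered (f^[i] w₀) (f^[i] w₁) (f^[i] w₂) (f^[i] w₃) := by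
    intro i hi
    rcases h.strict_iterate hf hi with m | m <;> rcases ho with ⟨i, j, k⟩ | ⟨i, j, k⟩
    · exact Or.inl ⟨m h₀ h₁ i, m h₁ h₂ j, m h₂ h₃ k⟩
    · exact Or.inr ⟨m h₃ h₂ i, m h₂ h₁ j, m h₁ h₀ k⟩
    · exact Or.inr ⟨m h₂ h₃ k, m h₁ h₂ j, m h₀ h₁ i⟩
    · exact Or.inl ⟨m h₁ h₀ k, m h₂ h₁ j, m h₃ h₂ i⟩
  have : ∀ i ≤ t, crossRatio w₀ w₁ w₂ w₃ ≤
      crossRatio (f^[i] w₀) (f^[i] w₁) (f^[i] w₂) (f^[i] w₃) := by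
    intro i
    induction i with
    | zero => exact fun _ => le_rfl
    | succ i ih =>
      intro hi
      refine (ih (Nat.le_of_succ_le hi)).trans ?_
      simp only [Function.iterate_succ', Function.comp_apply]
      refine hf.crossRatio_le (key i (Nat.le_of_succ_le hi)) ?_
      rcases h.side hf (Nat.lt_of_succ_le hi) with s | s
      · left
        rintro w (rfl | rfl)
        exacts [s _ h₀, s _ h₃]
      · right
        rintro w (rfl | rfl)
        exacts [s _ h₀, s _ h₃]
  exact this t le_rfl

lemma comp {t' : ℕ} {α' β' : ℝ} (h : IsBranch f a b c t x y α β)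
    (h' : IsBranch f a b c t' α β α' β') (hf : IsQuasiQuadratic f a b c) :
    IsBranch f a b c (t + t') x y α' β' := by
  refine ⟨h.lt, h'.lt_image, h.subset, fun i hi w hw => ?_, ?_⟩
  · by_cases hit : i < t
    · exact h.noncritical i hit w hw
    · have := h'.noncritical (i - t) (by omega) _ (h.mapsTo hf hw)
      rwa [← Function.iterate_add_apply, Nat.sub_add_cancel (by omega)] at this
  · rw [add_comm, Function.iterate_add_apply, Function.iterate_add_apply]
    rcases h.ends with ⟨e1, e2⟩ | ⟨e1, e2⟩ <;> rw [e1, e2]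
    · exact h'.ends
    · have := h'.ends
      tauto

/-- Restriction of a branch over a smaller interval. -/
lemma exists_sub {α' β' : ℝ} (h : IsBranch f a b c t x y α β) (hf : IsQuasiQuadratic f a b c)
    (h1 : α < α') (h2 : α' < β') (h3 : β' < β) :
    ∃ x' y', x < x' ∧ x' < y' ∧ y' < y ∧ IsBranch f a b c t x' y' α' β' ∧
      crossRatio x x' y' y ≤ crossRatio α α' β' β ∧
      ∀ z ∈ Ioo x y, f^[t] z ∈ Ioo α' β' → z ∈ Ioo x' y' := by
  obtain ⟨v, hv, ev⟩ := (h.bijOn hf).surjOn (show α' ∈ Ioo α β from ⟨h1, by linarith⟩)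
  obtain ⟨w, hw, ew⟩ := (h.bijOn hf).surjOn (show β' ∈ Ioo α β from ⟨by linarith, h3⟩)
  have hv' := Ioo_subset_Icc_self hv
  have hw' := Ioo_subset_Icc_self hw
  have hx : x ∈ Icc x y := ⟨le_rfl, h.lt.le⟩
  have hy : y ∈ Icc x y := ⟨h.lt.le, le_rfl⟩
  rcases h.strict hf with ⟨m, e1, e2⟩ | ⟨m, e1, e2⟩
  · have hvw : v < w := (m.lt_iff_lt hv' hw').1 (by rwa [ev, ew])
    refine ⟨v, w, hv.1, hvw, hw.2, ⟨hvw, h2, (Icc_subset_Icc hv'.1 hw'.2).trans h.subset,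
      fun i hi z hz => h.noncritical i hi z (Ioo_subset_Ioo hv'.1 hw'.2 hz), Or.inl ⟨ev, ew⟩⟩, ?_, ?_⟩
    · have := h.crossRatio_le hf (Or.inl ⟨hv.1, hvw, hw.2⟩) hx hy
      rwa [ev, ew, e1, e2] at this
    · intro z hz hz'
      have hzI := Ioo_subset_Icc_self hz
      exact ⟨(m.lt_iff_lt hv' hzI).1 (by rw [ev]; exact hz'.1),
        (m.lt_iff_lt hzI hw').1 (by rw [ew]; exact hz'.2)⟩
  · have hvw : w < v := (m.lt_iff_gt hv' hw').1 (by rwa [ev, ew])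
    refine ⟨w, v, hw.1, hvw, hv.2, ⟨hvw, h2, (Icc_subset_Icc hw'.1 hv'.2).trans h.subset,
      fun i hi z hz => h.noncritical i hi z (Ioo_subset_Ioo hw'.1 hv'.2 hz), Or.inr ⟨ew, ev⟩⟩, ?_, ?_⟩
    · have := h.crossRatio_le hf (Or.inl ⟨hw.1, hvw, hv.2⟩) hx hy
      rwa [ev, ew, e1, e2, crossRatio_reverse α α' β' β] at this
    · intro z hz hz'
      have hzI := Ioo_subset_Icc_self hz
      exact ⟨(m.lt_iff_gt hzI hw').1 (by rw [ew]; exact hz'.2),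
        (m.lt_iff_gt hv' hzI).1 (by rw [ev]; exact hz'.1)⟩

lemma iterate_mem (h : IsBranch f a b c t x y α β) (hf : IsQuasiQuadratic f a b c) {j : ℕ}
    (hj : j ≤ t) {z w e : ℝ} (hz : z ∈ Ioo x y) (hw : w ∈ Ioo x y)
    (he : e ∈ uIcc (f^[j] z) (f^[j] w)) : f^[t - j] e ∈ Ioo α β := by
  have hsub : uIcc z w ⊆ Ioo x y := ordConnected_Ioo.uIcc_subset hz hw
  obtain ⟨v, hv, rfl⟩ := intermediate_value_uIcc ((hf.continuousOn_iterate j).mono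
    (hsub.trans (Ioo_subset_Icc_self.trans h.subset_Icc))) he
  rw [← Function.iterate_add_apply, Nat.sub_add_cancel hj]
  exact h.mapsTo hf (hsub hv)

lemma avoid (h : IsBranch f a b c t x y α β) (hf : IsQuasiQuadratic f a b c) {j : ℕ}
    (hj : j ≤ t) {z l u : ℝ} (hz : z ∈ Ioo x y) (hzj : f^[j] z ∉ Ioo l u)
    (hl : f^[t - j] l ∉ Ioo α β) (hu : f^[t - j] u ∉ Ioo α β) {w : ℝ} (hw : w ∈ Icc x y) :
    f^[j] w ∉ Ioo l u := by
  have hin : ∀ v ∈ Ioo x y, f^[j] v ∉ Ioo l u := by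
    intro v hv hm
    by_cases h1 : f^[j] z ≤ l
    · exact hl (h.iterate_mem hf hj hz hv (mem_uIcc.2 (Or.inl ⟨h1, hm.1.le⟩)))
    · have h2 : u ≤ f^[j] z := by
        by_contra! h2
        exact hzj ⟨not_le.1 h1, h2⟩
      exact hu (h.iterate_mem hf hj hz hv (mem_uIcc.2 (Or.inr ⟨hm.2.le, h2⟩)))
  have hcont : ContinuousOn f^[j] (closure (Ioo x y)) := by
    rw [closure_Ioo h.lt.ne]
    exact (hf.continuousOn_iterate j).mono h.subset_Icc
  rw [← closure_Ioo h.lt.ne] at hw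
  exact closure_minimal (s := f^[j] '' Ioo x y) (t := (Ioo l u)ᶜ)
    (by rintro _ ⟨v, hv, rfl⟩; exact hin v hv)
    isOpen_Ioo.isClosed_compl (hcont.image_closure (mem_image_of_mem _ hw))

lemma subset_of_notMem (h : IsBranch f a b c t x y α β) (hf : IsQuasiQuadratic f a b c) {z l u : ℝ}
    (hz : z ∈ Ioo x y) (hz' : z ∈ Ioo l u) (hl : f^[t] l ∉ Ioo α β) (hu : f^[t] u ∉ Ioo α β) :
    l ≤ x ∧ y ≤ u := by
  constructor
  · by_contra! hcon
    exact hl (h.mapsTo hf ⟨hcon, hz'.1.trans hz.2⟩)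
  · by_contra! hcon
    exact hu (h.mapsTo hf ⟨hz.1.trans hz'.2, hcon⟩)

end IsBranch

/-- Existence of the branch of `f^t` over `(α, β)` around `z`, if the pull-backs of `(α, β)` along
the orbit of `z` are kept away from `c`. -/
lemma exists_isBranch (hf : IsQuasiQuadratic f a b c) {α β : ℝ} (hαβ : Icc α β ⊆ Ioo a b)
    {t : ℕ} {z : ℝ} (hz : z ∈ Icc a b) (hzt : f^[t] z ∈ Ioo α β)
    (H : ∀ i < t, ∃ e ∈ uIcc c (f^[i] z), f^[t - i] e ∉ Ioo α β) :
    ∃ x y, z ∈ Ioo x y ∧ IsBranch f a b c t x y α β := by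
  induction t generalizing z with
  | zero =>
    exact ⟨α, β, hzt, hzt.1.trans hzt.2, hzt.1.trans hzt.2, hαβ, fun i hi => absurd hi (by omega),
      Or.inl ⟨rfl, rfl⟩⟩
  | succ t ih =>
    obtain ⟨x, y, hm, hb⟩ := ih (hf.mapsTo hz) hzt fun i hi => by
      have := H (i + 1) (by omega)
      rwa [Nat.add_sub_add_right, Function.iterate_succ_apply] at this
    have hfc : f c ∉ Ioo x y := by
      intro hfc
      obtain ⟨e, he, hne⟩ := H 0 (by omega)
      have := hb.mapsTo hf (ordConnected_Ioo.uIcc_subset hfc hm (hf.apply_mem_uIcc hz he))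
      exact hne this
    obtain ⟨x', y', hz', hsub, hc, e⟩ := hf.exists_pullback hz hm hb.subset hfc
    have h1 : IsBranch f a b c 1 x' y' x y :=
      ⟨hz'.1.trans hz'.2, hb.lt, hsub, fun i hi w hw => by
        obtain rfl : i = 0 := by omega
        rintro rfl
        exact hc hw, e⟩
    refine ⟨x', y', hz', ?_⟩
    rw [add_comm]
    exact h1.comp hb hf


lemma connectedComponentIn_eq_Ioo {S : Set ℝ} {x y z : ℝ} (hz : z ∈ Ioo x y) (hS : Ioo x y ⊆ S)
    (hx : x ∉ S) (hy : y ∉ S) : connectedComponentIn S z = Ioo x y := by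
  refine Subset.antisymm (fun w hw => ?_) (isPreconnected_Ioo.subset_connectedComponentIn hz hS)
  have hoc := (isPreconnected_connectedComponentIn (F := S) (x := z)).ordConnected
  have hzz : z ∈ connectedComponentIn S z := mem_connectedComponentIn (hS hz)
  have hsub := connectedComponentIn_subset S z
  constructor
  · by_contra! h
    exact hx (hsub (hoc.out hw hzz ⟨h, hz.1.le⟩))
  · by_contra! h
    exact hy (hsub (hoc.out hzz hw ⟨hz.2.le, h⟩))

lemma Ioo_inj {x y x' y' : ℝ} (h : x < y) (h' : x' < y') (e : Ioo x y = Ioo x' y') :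
    x = x' ∧ y = y' := by
  have h1 := congrArg sInf e
  have h2 := congrArg sSup e
  rw [csInf_Ioo h, csInf_Ioo h'] at h1
  rw [csSup_Ioo h, csSup_Ioo h'] at h2
  exact ⟨h1, h2⟩

lemma exists_end_mem_uIcc {l u c w : ℝ} (hc : c ∈ Ioo l u) (hw : w ∉ Ioo l u) :
    ∃ e ∈ ({l, u} : Set ℝ), e ∈ uIcc c w := by
  by_cases h : w ≤ l
  · exact ⟨l, by simp, mem_uIcc.2 (Or.inr ⟨h, hc.1.le⟩)⟩
  · refine ⟨u, by simp, mem_uIcc.2 (Or.inl ⟨hc.2.le, ?_⟩)⟩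
    by_contra! h'
    exact hw ⟨not_le.1 h, h'⟩

lemma IsRecurrent.exists_ge (h : IsRecurrent f c) {U : Set ℝ} (hU : IsOpen U) (hc : c ∈ U) (N : ℕ) :
    ∃ t, N ≤ t ∧ f^[t] c ∈ U :=
  frequently_atTop.1 (mapClusterPt_iff_frequently.1 h U (hU.mem_nhds hc)) N

lemma exists_isFirstPassage {A : Set ℝ} (h : ∃ t, 1 ≤ t ∧ f^[t] c ∈ A) :
    ∃ t, IsFirstPassage f c A t := by
  classical
  exact ⟨Nat.find h, (Nat.find_spec h).1, (Nat.find_spec h).2,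
    fun s h1 hs hA => Nat.find_min h hs ⟨h1, hA⟩⟩

/-- A symmetric interval around `c` whose boundary never returns to it. -/
structure IsNice (f : ℝ → ℝ) (a b c α β : ℝ) : Prop where
  left_mem : α ∈ Ioo a c
  right_mem : β ∈ Ioo c b
  symm : f α = f β
  nice : ∀ t : ℕ, 1 ≤ t → f^[t] α ∉ Ioo α β

lemma iterate_eq_of_eq {α β : ℝ} (h : f α = f β) {t : ℕ} (ht : 1 ≤ t) : f^[t] β = f^[t] α := by
  obtain ⟨s, rfl⟩ : ∃ s, t = s + 1 := ⟨t - 1, by omega⟩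
  rw [Function.iterate_succ_apply, Function.iterate_succ_apply, h]

namespace IsNice

variable {α β : ℝ}

lemma nice_ends (h : IsNice f a b c α β) {t : ℕ} (ht : 1 ≤ t) {e : ℝ} (he : e ∈ ({α, β} : Set ℝ)) :
    f^[t] e ∉ Ioo α β := by
  rcases he with rfl | rfl
  · exact h.nice t ht
  · rw [iterate_eq_of_eq h.symm ht]; exact h.nice t ht

lemma crit_mem (h : IsNice f a b c α β) : c ∈ Ioo α β := ⟨h.left_mem.2, h.right_mem.1⟩

lemma lt (h : IsNice f a b c α β) : α < β := h.left_mem.2.trans h.right_mem.1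

lemma subset (h : IsNice f a b c α β) : Icc α β ⊆ Ioo a b :=
  Icc_subset_Ioo h.left_mem.1 h.right_mem.2

/-- The boundary of a branch over a nice interval never returns after time `i₀`, if the branch
follows an orbit that does not return between `i₀` and its end. -/
lemma branch_ends_notMem (h : IsNice f a b c α β) (hf : IsQuasiQuadratic f a b c) {t i₀ : ℕ}
    {x y z : ℝ} (hB : IsBranch f a b c t x y α β) (hz : z ∈ Ioo x y)
    (hret : ∀ i, i₀ ≤ i → i < t → f^[i] z ∉ Ioo α β) {i : ℕ} (hi : i₀ ≤ i) {e : ℝ}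
    (he : e ∈ ({x, y} : Set ℝ)) : f^[i] e ∉ Ioo α β := by
  have heI : e ∈ Icc x y := by
    rcases he with rfl | rfl
    exacts [⟨le_rfl, hB.lt.le⟩, ⟨hB.lt.le, le_rfl⟩]
  rcases lt_or_ge i t with hit | hit
  · exact hB.avoid hf hit.le hz (hret i hi hit) (h.nice_ends (by omega) (by simp))
      (h.nice_ends (by omega) (by simp)) heI
  · have hte : f^[t] e ∈ ({α, β} : Set ℝ) := by
      simp only [mem_insert_iff, mem_singleton_iff] at he ⊢
      rcases hB.ends with ⟨e1, e2⟩ | ⟨e1, e2⟩ <;> rcases he with rfl | rfl <;> tauto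
    rcases hit.eq_or_lt with rfl | hlt
    · rcases hte with h' | h'
      · rw [h']; exact fun h => lt_irrefl _ h.1
      · rw [mem_singleton_iff.1 h']; exact fun h => lt_irrefl _ h.2
    · have := h.nice_ends (t := i - t) (by omega) hte
      rwa [← Function.iterate_add_apply, Nat.sub_add_cancel hit] at this

/-- A branch along a first return is a component of the domain of the first return map. -/
lemma connectedComponentIn_eq (h : IsNice f a b c α β) (hf : IsQuasiQuadratic f a b c) {t : ℕ}
    {x y z : ℝ} (hB : IsBranch f a b c t x y α β) (hz : z ∈ Ioo x y) (ht : 1 ≤ t)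
    (hzT : z ∈ Ioo α β) (hret : ∀ i, 1 ≤ i → i < t → f^[i] z ∉ Ioo α β) :
    connectedComponentIn (returnDomain f (Ioo α β)) z = Ioo x y := by
  have hsub := hB.subset_of_notMem hf hz hzT (h.nice_ends ht (by simp)) (h.nice_ends ht (by simp))
  refine connectedComponentIn_eq_Ioo hz (fun w hw => ⟨Ioo_subset_Ioo hsub.1 hsub.2 hw, t, ht,
    hB.mapsTo hf hw⟩) ?_ ?_
  · rintro ⟨-, s, hs, hm⟩
    exact h.branch_ends_notMem hf hB hz hret hs (by simp) hm
  · rintro ⟨-, s, hs, hm⟩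
    exact h.branch_ends_notMem hf hB hz hret hs (by simp) hm

/-- The central component of the domain of the first return map to a nice interval. -/
lemma exists_central (h : IsNice f a b c α β) (hf : IsQuasiQuadratic f a b c) {r : ℕ}
    (hr : IsFirstPassage f c (Ioo α β) r) :
    ∃ l u, connectedComponentIn (returnDomain f (Ioo α β)) c = Ioo l u ∧ IsNice f a b c l u ∧
      α ≤ l ∧ u ≤ β ∧ (∀ t, 1 ≤ t → f^[t] l ∉ Ioo α β) ∧
      ∃ x y, f c ∈ Ioo x y ∧ IsBranch f a b c (r - 1) x y α β ∧ (f l = x ∨ f l = y) ∧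
        ∀ z ∈ Ioo l u, f z ∈ Ioo x y := by
  obtain ⟨hr1, hrm, hrf⟩ := hr
  have hcI := Ioo_subset_Icc_self hf.crit_mem
  have hret : ∀ i, 0 ≤ i → i < r - 1 → f^[i] (f c) ∉ Ioo α β := fun i _ hi => by
    rw [← Function.iterate_succ_apply]; exact hrf _ (by omega) (by omega)
  obtain ⟨x, y, hm, hB⟩ := exists_isBranch hf h.subset (t := r - 1) (hf.mapsTo hcI)
    (by rw [← Function.iterate_succ_apply, Nat.succ_eq_add_one, Nat.sub_add_cancel hr1]; exact hrm)
    fun i hi => by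
      obtain ⟨e, he, he'⟩ := exists_end_mem_uIcc h.crit_mem (hret i (by omega) hi)
      exact ⟨e, he', h.nice_ends (by omega) he⟩
  obtain ⟨l, hl, u, hu, hlu, hle, hmap⟩ := hf.exists_critical_pullback hB.subset hm
  have hl' : ∀ t, 1 ≤ t → f^[t] l ∉ Ioo α β := by
    intro t ht
    obtain ⟨s, rfl⟩ : ∃ s, t = s + 1 := ⟨t - 1, by omega⟩
    rw [Function.iterate_succ_apply]
    exact h.branch_ends_notMem hf hB hm hret (by omega)
      (by simpa only [mem_insert_iff, mem_singleton_iff] using hle)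
  have hmap' : ∀ z ∈ Ioo l u, f^[r] z ∈ Ioo α β := by
    intro z hz
    have := hB.mapsTo hf (hmap z hz)
    rwa [← Function.iterate_succ_apply, Nat.succ_eq_add_one, Nat.sub_add_cancel hr1] at this
  have h1 : α ≤ l := by
    by_contra! hcon
    exact h.nice_ends hr1 (by simp) (hmap' α ⟨hcon, h.left_mem.2.trans hu.1⟩)
  have h2 : u ≤ β := by
    by_contra! hcon
    exact h.nice_ends hr1 (by simp) (hmap' β ⟨hl.2.trans h.right_mem.1, hcon⟩)
  refine ⟨l, u, ?_, ⟨hl, hu, hlu, fun t ht hm => hl' t ht (Ioo_subset_Ioo h1 h2 hm)⟩, h1, h2, hl',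
    x, y, hm, hB, hle, hmap⟩
  refine connectedComponentIn_eq_Ioo ⟨hl.2, hu.1⟩
    (fun w hw => ⟨Ioo_subset_Ioo h1 h2 hw, r, hr1, hmap' w hw⟩) ?_ ?_
  · rintro ⟨-, s, hs, hm⟩
    exact hl' s hs hm
  · rintro ⟨-, s, hs, hm⟩
    rw [iterate_eq_of_eq hlu hs] at hm
    exact hl' s hs hm

end IsNice

/-- The principal nest with its endpoints `l n`, `u n` and the first return times `r n` of `c`. -/
structure NestData (f : ℝ → ℝ) (a b c : ℝ) (J : Set ℝ) (l u : ℕ → ℝ) (r : ℕ → ℕ) : Prop where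
  nest_eq : ∀ n, nest f c J n = Ioo (l n) (u n)
  isNice : ∀ n, IsNice f a b c (l n) (u n)
  avoid_left : ∀ n t, 1 ≤ t → f^[t] (l (n + 1)) ∉ Ioo (l n) (u n)
  lt_left : ∀ n, l n < l (n + 1)
  lt_right : ∀ n, u (n + 1) < u n
  first : ∀ n, IsFirstPassage f c (Ioo (l n) (u n)) (r n)
  r_lt : ∀ n, r n < r (n + 1)
  branch : ∀ n, ∃ x y, f c ∈ Ioo x y ∧ IsBranch f a b c (r n - 1) x y (l n) (u n) ∧
    (f (l (n + 1)) = x ∨ f (l (n + 1)) = y) ∧ ∀ z ∈ Ioo (l (n + 1)) (u (n + 1)), f z ∈ Ioo x y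

lemma exists_nestData (hf : IsQuasiQuadratic f a b c) (hI : IsInitialInterval f a b c p q)
    (hrec : IsRecurrent f c) (hnc : NoCentralReturns f c (Ioo p q)) :
    ∃ l u r, NestData f a b c (Ioo p q) l u r := by
  have hr : ∀ {α β}, IsNice f a b c α β → ∃ r, IsFirstPassage f c (Ioo α β) r := fun h =>
    exists_isFirstPassage (hrec.exists_ge isOpen_Ioo h.crit_mem 1)
  have key : ∀ n, ∃ α β, nest f c (Ioo p q) n = Ioo α β ∧ IsNice f a b c α β := by
    intro n
    induction n with
    | zero => exact ⟨p, q, rfl, hI.left_mem, hI.right_mem, hI.symmetric, hI.nice⟩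
    | succ n ih =>
      obtain ⟨α, β, e, h⟩ := ih
      obtain ⟨r, hr⟩ := hr h
      obtain ⟨l, u, e', h', -⟩ := h.exists_central hf hr
      exact ⟨l, u, by rw [nest, e, e'], h'⟩
  choose l u hlu hnice using key
  choose r hr using fun n => hr (hnice n)
  have key : ∀ n, l n ≤ l (n + 1) ∧ u (n + 1) ≤ u n ∧
      (∀ t, 1 ≤ t → f^[t] (l (n + 1)) ∉ Ioo (l n) (u n)) ∧
      ∃ x y, f c ∈ Ioo x y ∧ IsBranch f a b c (r n - 1) x y (l n) (u n) ∧
        (f (l (n + 1)) = x ∨ f (l (n + 1)) = y) ∧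
        ∀ z ∈ Ioo (l (n + 1)) (u (n + 1)), f z ∈ Ioo x y := by
    intro n
    obtain ⟨l', u', e', h', H⟩ := (hnice n).exists_central hf (hr n)
    have e := hlu (n + 1)
    rw [nest, hlu n, e'] at e
    obtain ⟨rfl, rfl⟩ := Ioo_inj h'.lt (hnice (n + 1)).lt e
    exact H
  have hncr : ∀ n, f^[r n] c ∉ Ioo (l (n + 1)) (u (n + 1)) := by
    intro n
    rw [← hlu]
    exact hnc (n + 1) (by omega) _ (by rw [Nat.add_sub_cancel, hlu]; exact hr n)
  have hne : ∀ n, ¬ (l n = l (n + 1) ∧ u (n + 1) = u n) := by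
    rintro n ⟨h1, h2⟩
    apply hncr n
    rw [← h1, h2]
    exact (hr n).2.1
  have injl : InjOn f (Icc a c) := by
    rcases hf.unimodal with h | h
    exacts [h.1.injOn, h.1.injOn]
  have injr : InjOn f (Icc c b) := by
    rcases hf.unimodal with h | h
    exacts [h.2.1.injOn, h.2.1.injOn]
  refine ⟨l, u, r, hlu, hnice, fun n => (key n).2.2.1, fun n => ?_, fun n => ?_, hr, fun n => ?_,
    fun n => (key n).2.2.2⟩
  · refine lt_of_le_of_ne (key n).1 fun h => hne n ⟨h, ?_⟩
    refine injr (Ioo_subset_Icc_self (hnice _).right_mem) (Ioo_subset_Icc_self (hnice _).right_mem) ?_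
    rw [← (hnice _).symm, ← (hnice _).symm, h]
  · refine lt_of_le_of_ne (key n).2.1 fun h => hne n ⟨?_, h⟩
    refine injl (Ioo_subset_Icc_self (hnice _).left_mem) (Ioo_subset_Icc_self (hnice _).left_mem) ?_
    rw [(hnice _).symm, (hnice _).symm, h]
  · refine lt_of_le_of_ne ?_ fun h => ?_
    · by_contra! h
      exact (hr n).2.2 _ (hr (n + 1)).1 h
        (Ioo_subset_Ioo (key n).1 (key n).2.1 (hr (n + 1)).2.1)
    · apply hncr n
      rw [h]
      exact (hr (n + 1)).2.1

variable {J : Set ℝ} {l u : ℕ → ℝ} {r : ℕ → ℕ} {A : ℝ}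

namespace NestData

lemma lt (D : NestData f a b c J l u r) (n : ℕ) : l n < u n := (D.isNice n).lt

lemma crit_mem (D : NestData f a b c J l u r) (n : ℕ) : c ∈ Ioo (l n) (u n) := (D.isNice n).crit_mem

lemma monotone_l (D : NestData f a b c J l u r) : Monotone l :=
  monotone_nat_of_le_succ fun n => (D.lt_left n).le

lemma antitone_u (D : NestData f a b c J l u r) : Antitone u :=
  antitone_nat_of_succ_le fun n => (D.lt_right n).le

lemma strictMono_r (D : NestData f a b c J l u r) : StrictMono r := strictMono_nat_of_lt_succ D.r_lt

lemma one_le_r (D : NestData f a b c J l u r) (n : ℕ) : 1 ≤ r n := (D.first n).1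

lemma Ioo_subset (D : NestData f a b c J l u r) {m n : ℕ} (h : m ≤ n) :
    Ioo (l n) (u n) ⊆ Ioo (l m) (u m) := Ioo_subset_Ioo (D.monotone_l h) (D.antitone_u h)

lemma notMem_of_lt (D : NestData f a b c J l u r) {n t : ℕ} (h1 : 1 ≤ t) (ht : t < r n) :
    f^[t] c ∉ Ioo (l n) (u n) := (D.first n).2.2 t h1 ht

lemma avoid_ends (D : NestData f a b c J l u r) (n : ℕ) {t : ℕ} (ht : 1 ≤ t) {e : ℝ}
    (he : e ∈ ({l (n + 1), u (n + 1)} : Set ℝ)) : f^[t] e ∉ Ioo (l n) (u n) := by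
  rcases he with rfl | rfl
  · exact D.avoid_left n t ht
  · rw [iterate_eq_of_eq (D.isNice _).symm ht]; exact D.avoid_left n t ht

/-- Orbit segments that avoid `I^{n+1}` and end in `I^n` have branches over `I^n`. -/
lemma exists_branch_of_avoid (D : NestData f a b c J l u r) (hf : IsQuasiQuadratic f a b c)
    {n t : ℕ} {z : ℝ} (hz : z ∈ Icc a b) (hzt : f^[t] z ∈ Ioo (l n) (u n))
    (h : ∀ i < t, f^[i] z ∉ Ioo (l (n + 1)) (u (n + 1))) :
    ∃ x y, z ∈ Ioo x y ∧ IsBranch f a b c t x y (l n) (u n) :=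
  exists_isBranch hf (D.isNice n).subset hz hzt fun i hi => by
    obtain ⟨e, he, he'⟩ := exists_end_mem_uIcc (D.crit_mem (n + 1)) (h i hi)
    exact ⟨e, he', D.avoid_ends n (by omega) he⟩

lemma apply_mem (D : NestData f a b c J l u r) (hf : IsQuasiQuadratic f a b c) {n : ℕ} {z : ℝ}
    (hz : z ∈ Ioo (l (n + 1)) (u (n + 1))) : f^[r n] z ∈ Ioo (l n) (u n) := by
  obtain ⟨x, y, -, hB, -, hm⟩ := D.branch n
  have := hB.mapsTo hf (hm z hz)
  rwa [← Function.iterate_succ_apply, Nat.succ_eq_add_one, Nat.sub_add_cancel (D.one_le_r n)] at this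

lemma apply_end (D : NestData f a b c J l u r) (n : ℕ) :
    f^[r n] (l (n + 1)) ∈ ({l n, u n} : Set ℝ) := by
  obtain ⟨x, y, -, hB, he, -⟩ := D.branch n
  rw [← Nat.sub_add_cancel (D.one_le_r n), Function.iterate_succ_apply]
  simp only [mem_insert_iff, mem_singleton_iff]
  rcases hB.ends with ⟨e1, e2⟩ | ⟨e1, e2⟩ <;> rcases he with h | h <;> rw [h] <;> tauto

end NestData

lemma IsQuasiQuadratic.critical_value_extremal (hf : IsQuasiQuadratic f a b c) :
    (∀ w ∈ Icc a b, w ≠ c → f w < f c) ∨ (∀ w ∈ Icc a b, w ≠ c → f c < f w) := by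
  have hc := hf.crit_mem
  have mcl : c ∈ Icc a c := ⟨hc.1.le, le_rfl⟩
  have mcr : c ∈ Icc c b := ⟨le_rfl, hc.2.le⟩
  rcases hf.unimodal with ⟨k1, k2, -⟩ | ⟨k1, k2, -⟩
  · left
    intro w hw hne
    rcases lt_or_gt_of_ne hne with h | h
    · exact k1 ⟨hw.1, h.le⟩ mcl h
    · exact k2 mcr ⟨h.le, hw.2⟩ h
  · right
    intro w hw hne
    rcases lt_or_gt_of_ne hne with h | h
    · exact k1 ⟨hw.1, h.le⟩ mcl h
    · exact k2 mcr ⟨h.le, hw.2⟩ h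

lemma crossRatio_le_of_le {w₀ w₁ w₂ w₃ g U V : ℝ} (hU : 0 < U) (hV : 0 < V) (hg : |w₂ - w₁| ≤ g)
    (hU' : U ≤ |w₁ - w₀|) (hV' : V ≤ |w₃ - w₂|) :
    crossRatio w₀ w₁ w₂ w₃ ≤ (1 + g / U) * (1 + g / V) := by
  have hg0 : 0 ≤ g := (abs_nonneg _).trans hg
  unfold crossRatio
  gcongr

lemma add_le_mul_crossRatio {w₀ w₁ w₂ w₃ t : ℝ} (h : w₁ ≠ w₀) (ht : |w₁ - w₀| ≤ t) :
    |w₂ - w₁| + t ≤ t * crossRatio w₀ w₁ w₂ w₃ := by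
  have h0 : 0 < |w₁ - w₀| := abs_pos.2 (sub_ne_zero.2 h)
  have ht0 : 0 < t := h0.trans_le ht
  have h1 : |w₂ - w₁| / t ≤ |w₂ - w₁| / |w₁ - w₀| := by gcongr
  have h2 : 0 ≤ |w₂ - w₁| / |w₃ - w₂| := by positivity
  have h3 : 0 ≤ |w₂ - w₁| / |w₁ - w₀| := by positivity
  have h4 : 1 + |w₂ - w₁| / t ≤ crossRatio w₀ w₁ w₂ w₃ := by
    unfold crossRatio
    nlinarith [mul_nonneg h2 h3]
  calc |w₂ - w₁| + t = t * (1 + |w₂ - w₁| / t) := by field_simp; ring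
    _ ≤ _ := by gcongr

lemma one_le_crossRatio (w₀ w₁ w₂ w₃ : ℝ) : 1 ≤ crossRatio w₀ w₁ w₂ w₃ := by
  have h2 : 0 ≤ |w₂ - w₁| / |w₃ - w₂| := by positivity
  have h3 : 0 ≤ |w₂ - w₁| / |w₁ - w₀| := by positivity
  unfold crossRatio
  nlinarith [mul_nonneg h2 h3]

lemma poincareLength_Ioo {l l' u' u : ℝ} (h1 : l < l') (h2 : l' < u') (h3 : u' < u) :
    poincareLength (Ioo l' u') (Ioo l u) = Real.log (crossRatio l l' u' u) := by
  have h : l < u := by linarith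
  have k1 : 0 < l' - l := by linarith
  have k2 : 0 < u' - l' := by linarith
  have k3 : 0 < u - u' := by linarith
  rw [poincareLength, len, csSup_Ioo h2, csInf_Ioo h2, csInf_Ioo h, csSup_Ioo h, crossRatio,
    abs_of_pos k1, abs_of_pos k2, abs_of_pos k3, Real.log_mul (by positivity) (by positivity)]

lemma len_Ioo {l u : ℝ} (h : l < u) : len (Ioo l u) = u - l := by
  rw [len, csSup_Ioo h, csInf_Ioo h]

/-- The radius of the level-`n` interval in the coordinate in which `f` is exactly quadratic. -/
noncomputable def radius (f : ℝ → ℝ) (c : ℝ) (l : ℕ → ℝ) (n : ℕ) : ℝ := √|f (l n) - f c|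

lemma gap_bounds {k₁ k₂ X Y ρ ρ' : ℝ} (hY : 0 < Y) (hYX : Y ≤ X)
    (hρ : ρ' ≤ ρ) (h1 : k₁ ^ 2 * (X ^ 2 - Y ^ 2) ≤ ρ ^ 2 - ρ' ^ 2)
    (h2 : ρ ^ 2 - ρ' ^ 2 ≤ k₂ ^ 2 * (X ^ 2 - Y ^ 2)) (hX1 : k₁ * X ≤ ρ) (hX2 : ρ ≤ k₂ * X)
    (hY1 : k₁ * Y ≤ ρ') (hY2 : ρ' ≤ k₂ * Y) :
    k₁ * (ρ - ρ') ≤ k₂ ^ 2 * (X - Y) ∧ k₁ ^ 2 * (X - Y) ≤ k₂ * (ρ - ρ') := by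
  have hXY : 0 < X + Y := by linarith
  constructor
  · refine le_of_mul_le_mul_right ?_ hXY
    nlinarith [mul_le_mul_of_nonneg_left (add_le_add hX1 hY1) (sub_nonneg.2 hρ)]
  · refine le_of_mul_le_mul_right ?_ hXY
    nlinarith [mul_le_mul_of_nonneg_left (add_le_add hX2 hY2) (sub_nonneg.2 hρ)]

/-- Comparison of the lengths in the principal nest with the radii. -/
structure Comparable (f : ℝ → ℝ) (c : ℝ) (l u : ℕ → ℝ) (A : ℝ) : Prop where
  one_le : 1 ≤ A
  pos : ∀ n, 0 < radius f c l n
  lt : ∀ n, radius f c l (n + 1) < radius f c l n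
  le_left : ∀ n, radius f c l n ≤ A * (c - l n)
  left_le : ∀ n, c - l n ≤ A * radius f c l n
  le_right : ∀ n, radius f c l n ≤ A * (u n - c)
  right_le : ∀ n, u n - c ≤ A * radius f c l n
  le_left_gap : ∀ n, radius f c l n - radius f c l (n + 1) ≤ A * (l (n + 1) - l n)
  left_gap_le : ∀ n, l (n + 1) - l n ≤ A * (radius f c l n - radius f c l (n + 1))
  le_right_gap : ∀ n, radius f c l n - radius f c l (n + 1) ≤ A * (u n - u (n + 1))
  right_gap_le : ∀ n, u n - u (n + 1) ≤ A * (radius f c l n - radius f c l (n + 1))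

namespace NestData

lemma exists_comparable (D : NestData f a b c J l u r) (hf : IsQuasiQuadratic f a b c) :
    ∃ A, Comparable f c l u A := by
  obtain ⟨m, M, hm, hM, H⟩ := hf.exists_quadratic_bounds (D.isNice 0).left_mem (D.isNice 0).right_mem
  set k₁ := √m with hk₁
  set k₂ := √M with hk₂
  have k1 : 0 < k₁ := Real.sqrt_pos.2 hm
  have k2 : 0 < k₂ := Real.sqrt_pos.2 hM
  have e1 : m = k₁ ^ 2 := (Real.sq_sqrt hm.le).symm
  have e2 : M = k₂ ^ 2 := (Real.sq_sqrt hM.le).symm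
  rw [e1, e2] at H
  have hsq : ∀ n, radius f c l n ^ 2 = |f (l n) - f c| := fun n => Real.sq_sqrt (abs_nonneg _)
  have hr0 : ∀ n, 0 ≤ radius f c l n := fun n => Real.sqrt_nonneg _
  have hl : ∀ n, 0 < c - l n := fun n => by linarith [(D.crit_mem n).1]
  have hu : ∀ n, 0 < u n - c := fun n => by linarith [(D.crit_mem n).2]
  have L : ∀ n, k₁ * (c - l n) ≤ radius f c l n ∧ radius f c l n ≤ k₂ * (c - l n) := by
    intro n
    have h := H (l n) c (Or.inl ⟨D.monotone_l n.zero_le, (D.crit_mem n).1.le, le_rfl⟩)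
    simp only [sub_self, abs_zero, sub_zero, ← hsq] at h
    have hn := hl n
    constructor
    · refine le_of_sq_le_sq ?_ (hr0 n)
      nlinarith [h.1]
    · refine le_of_sq_le_sq ?_ (by positivity)
      nlinarith [h.2]
  have R : ∀ n, k₁ * (u n - c) ≤ radius f c l n ∧ radius f c l n ≤ k₂ * (u n - c) := by
    intro n
    have h := H (u n) c (Or.inr ⟨le_rfl, (D.crit_mem n).2.le, D.antitone_u n.zero_le⟩)
    simp only [sub_self, abs_zero, sub_zero, ← (D.isNice n).symm, ← hsq] at h
    have hn := hu n
    constructor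
    · refine le_of_sq_le_sq ?_ (hr0 n)
      nlinarith [h.1]
    · refine le_of_sq_le_sq ?_ (by positivity)
      nlinarith [h.2]
  have hpos : ∀ n, 0 < radius f c l n := fun n => (mul_pos k1 (hl n)).trans_le (L n).1
  have gapL := fun n => H (l n) (l (n + 1)) (Or.inl ⟨D.monotone_l n.zero_le, (D.lt_left n).le,
    (D.crit_mem _).1.le⟩)
  have gapR := fun n => H (u n) (u (n + 1)) (Or.inr ⟨(D.crit_mem _).2.le, (D.lt_right n).le,
    D.antitone_u n.zero_le⟩)
  simp only [← (D.isNice _).symm, ← hsq] at gapL gapR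
  have hlt : ∀ n, radius f c l (n + 1) < radius f c l n := by
    intro n
    refine lt_of_pow_lt_pow_left₀ 2 (hr0 n) ?_
    have h1 := (gapR n).1
    have h2 : 0 < k₁ ^ 2 * ((u n - c) ^ 2 - (u (n + 1) - c) ^ 2) := by
      refine mul_pos (by positivity) ?_
      nlinarith [D.lt_right n, hu n, hu (n + 1)]
    linarith
  have gapL' := fun n => gap_bounds (hl (n + 1)) (by linarith [D.lt_left n] : c - l (n + 1) ≤ c - l n)
    (hlt n).le (by nlinarith [(gapL n).1]) (by nlinarith [(gapL n).2]) (L n).1 (L n).2 (L (n + 1)).1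
    (L (n + 1)).2
  have gapR' := fun n => gap_bounds (hu (n + 1)) (by linarith [D.lt_right n] : u (n + 1) - c ≤ u n - c)
    (hlt n).le (gapR n).1 (gapR n).2 (R n).1 (R n).2 (R (n + 1)).1 (R (n + 1)).2
  set A := 1 + k₂ + 1 / k₁ + k₂ ^ 2 / k₁ + k₂ / k₁ ^ 2 with hA
  have p1 : 0 < 1 / k₁ := by positivity
  have p2 : 0 < k₂ ^ 2 / k₁ := by positivity
  have p3 : 0 < k₂ / k₁ ^ 2 := by positivity
  have a2 : k₂ ≤ A := by rw [hA]; linarith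
  have a3 : 1 / k₁ ≤ A := by rw [hA]; linarith
  have a4 : k₂ ^ 2 / k₁ ≤ A := by rw [hA]; linarith
  have a5 : k₂ / k₁ ^ 2 ≤ A := by rw [hA]; linarith
  have u1 : ∀ {X ρ : ℝ}, 0 ≤ X → ρ ≤ k₂ * X → ρ ≤ A * X := fun hX h =>
    h.trans (mul_le_mul_of_nonneg_right a2 hX)
  have u2 : ∀ {X ρ : ℝ}, 0 ≤ ρ → k₁ * X ≤ ρ → X ≤ A * ρ := fun hρ h => by
    refine le_trans ?_ (mul_le_mul_of_nonneg_right a3 hρ)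
    rw [div_mul_eq_mul_div, le_div_iff₀ k1]; linarith
  have u3 : ∀ {X ρ : ℝ}, 0 ≤ X → k₁ * ρ ≤ k₂ ^ 2 * X → ρ ≤ A * X := fun hX h => by
    refine le_trans ?_ (mul_le_mul_of_nonneg_right a4 hX)
    rw [div_mul_eq_mul_div, le_div_iff₀ k1]; linarith
  have u4 : ∀ {X ρ : ℝ}, 0 ≤ ρ → k₁ ^ 2 * X ≤ k₂ * ρ → X ≤ A * ρ := fun hρ h => by
    refine le_trans ?_ (mul_le_mul_of_nonneg_right a5 hρ)
    rw [div_mul_eq_mul_div, le_div_iff₀ (by positivity)]; linarith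
  refine ⟨A, by rw [hA]; linarith, hpos, hlt, fun n => u1 (hl n).le (L n).2,
    fun n => u2 (hr0 n) (L n).1, fun n => u1 (hu n).le (R n).2, fun n => u2 (hr0 n) (R n).1,
    fun n => u3 ?_ ?_, fun n => u4 ?_ ?_, fun n => u3 ?_ ?_, fun n => u4 ?_ ?_⟩
  · linarith [D.lt_left n]
  · have := (gapL' n).1; linarith
  · linarith [hlt n]
  · have := (gapL' n).2; linarith
  · linarith [D.lt_right n]
  · have := (gapR' n).1; linarith
  · linarith [hlt n]
  · have := (gapR' n).2; linarith

lemma sq_radius (n : ℕ) : radius f c l n ^ 2 = |f (l n) - f c| := Real.sq_sqrt (abs_nonneg _)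

lemma sq_radius_lt (D : NestData f a b c J l u r) (hf : IsQuasiQuadratic f a b c) (n : ℕ) :
    radius f c l (n + 1) ^ 2 < radius f c l n ^ 2 := by
  obtain ⟨A, hA⟩ := D.exists_comparable hf
  exact pow_lt_pow_left₀ (hA.lt n) (hA.pos _).le two_ne_zero

/-- The boundary of the branch around the critical value over `I^n` never enters `I^n`. -/
lemma branch_ends (D : NestData f a b c J l u r) (hf : IsQuasiQuadratic f a b c) {n : ℕ} {x y : ℝ}
    (hB : IsBranch f a b c (r n - 1) x y (l n) (u n)) (hc : f c ∈ Ioo x y) (i : ℕ) {e : ℝ}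
    (he : e ∈ ({x, y} : Set ℝ)) : f^[i] e ∉ Ioo (l n) (u n) := by
  refine (D.isNice n).branch_ends_notMem hf hB hc (i₀ := 0) (fun i _ hi => ?_) i.zero_le he
  rw [← Function.iterate_succ_apply]
  exact D.notMem_of_lt (by omega) (by omega)

lemma iterate_pred (D : NestData f a b c J l u r) (n : ℕ) : f^[r n - 1] (f c) = f^[r n] c := by
  rw [← Function.iterate_succ_apply, Nat.succ_eq_add_one, Nat.sub_add_cancel (D.one_le_r n)]

/-- If `f c ∈ J(n+1) ⊆ (lam₁, lam₂) ⊆ (ξ₁, ξ₂) ⊆ J(n)` for the branches `J(n)` around the critical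
value, then the cross-ratio of the middle pair bounds the relative size of `I^{n+2}` in
`I^{n+1}`. -/
lemma sq_radius_le (D : NestData f a b c J l u r) (hf : IsQuasiQuadratic f a b c) {n : ℕ}
    {lam₁ lam₂ ξ₁ ξ₂ : ℝ} (h1 : ξ₁ < lam₁) (h2 : f c ∈ Ioo lam₁ lam₂) (h3 : lam₂ < ξ₂)
    (hlam : ∀ e ∈ ({lam₁, lam₂} : Set ℝ), f^[r (n + 1) - 1] e ∉ Ioo (l (n + 1)) (u (n + 1)))
    {s : ℕ} (hB : IsBranch f a b c s ξ₁ ξ₂ (l n) (u n)) :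
    radius f c l (n + 1) ^ 2 ≤ (radius f c l (n + 1) ^ 2 - radius f c l (n + 2) ^ 2) *
      crossRatio ξ₁ lam₁ lam₂ ξ₂ := by
  obtain ⟨x, y, hcx, hJ, he, -⟩ := D.branch n
  obtain ⟨x', y', hcx', hJ', he', -⟩ := D.branch (n + 1)
  have hξ := hB.subset_of_notMem hf ⟨h1.trans h2.1, h2.2.trans h3⟩ hcx
    (D.branch_ends hf hJ hcx s (by simp)) (D.branch_ends hf hJ hcx s (by simp))
  have hl := hJ'.subset_of_notMem hf hcx' h2 (hlam _ (by simp)) (hlam _ (by simp))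
  rw [sq_radius, sq_radius]
  have mem : ∀ k, l k ∈ Icc a b := fun k => by
    have := (D.isNice k).left_mem
    exact ⟨this.1.le, (this.2.trans hf.crit_mem.2).le⟩
  have ne : ∀ k, l k ≠ c := fun k => (D.crit_mem k).1.ne
  rcases hf.critical_value_extremal with h | h
  · have i1 := h _ (mem (n + 1)) (ne _)
    have i2 := h _ (mem (n + 2)) (ne _)
    have e1 : f (l (n + 1)) = x := he.resolve_right (by linarith [hcx.2])
    have e2 : f (l (n + 2)) = x' := he'.resolve_right (by intro h; linarith [hcx'.2])
    rw [e1, e2]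
    rw [abs_of_neg (by linarith [hcx.1]), abs_of_neg (by linarith [hcx'.1])]
    have key := add_le_mul_crossRatio (w₂ := lam₂) (w₃ := ξ₂) h1.ne'
      (show |lam₁ - ξ₁| ≤ x' - x by rw [abs_of_pos (by linarith)]; linarith)
    rw [abs_of_pos (by linarith [h2.1, h2.2])] at key
    linarith [h2.2]
  · have i1 := h _ (mem (n + 1)) (ne _)
    have i2 := h _ (mem (n + 2)) (ne _)
    have e1 : f (l (n + 1)) = y := he.resolve_left (by linarith [hcx.1])
    have e2 : f (l (n + 2)) = y' := he'.resolve_left (by intro h; linarith [hcx'.1])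
    rw [e1, e2]
    rw [abs_of_pos (by linarith [hcx.2]), abs_of_pos (by linarith [hcx'.2])]
    have key := add_le_mul_crossRatio (w₂ := lam₁) (w₃ := ξ₁) h3.ne
      (show |lam₂ - ξ₂| ≤ y - y' by rw [abs_sub_comm, abs_of_pos (by linarith)]; linarith)
    rw [abs_sub_comm, abs_of_pos (by linarith [h2.1, h2.2]), crossRatio_reverse] at key
    linarith [h2.1]

/-- The branch around the critical value along the first return to `I^{n+1}` extends over `I^n`. -/
lemma exists_extension (D : NestData f a b c J l u r) (hf : IsQuasiQuadratic f a b c) (n : ℕ) :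
    ∃ x y, f c ∈ Ioo x y ∧ IsBranch f a b c (r (n + 1) - 1) x y (l n) (u n) := by
  refine D.exists_branch_of_avoid hf (hf.mapsTo (Ioo_subset_Icc_self hf.crit_mem)) ?_ fun i hi => ?_
  · rw [D.iterate_pred]
    exact D.Ioo_subset n.le_succ (D.first (n + 1)).2.1
  · rw [← Function.iterate_succ_apply]
    exact D.notMem_of_lt (by omega) (by omega)

lemma sq_radius_le_crossRatio (D : NestData f a b c J l u r) (hf : IsQuasiQuadratic f a b c)
    (n : ℕ) :
    radius f c l (n + 1) ^ 2 ≤ (radius f c l (n + 1) ^ 2 - radius f c l (n + 2) ^ 2) *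
      crossRatio (l n) (l (n + 1)) (u (n + 1)) (u n) := by
  obtain ⟨ξ₁, ξ₂, hc, hB⟩ := D.exists_extension hf n
  obtain ⟨x, y, h1, h2, h3, hB', hcr, hm⟩ := hB.exists_sub hf (D.lt_left n) (D.lt (n + 1))
    (D.lt_right n)
  have hc' : f c ∈ Ioo x y := hm _ hc (by rw [D.iterate_pred]; exact (D.first (n + 1)).2.1)
  have := D.sq_radius_le hf h1 hc' h3 (fun e he => D.branch_ends hf hB' hc' _ he) hB
  exact this.trans (mul_le_mul_of_nonneg_left hcr (sub_nonneg.2 (D.sq_radius_lt hf (n + 1)).le))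

end NestData

/-- A sequence in `(0, 1]` that cannot decay twice in a row stays away from `0`. -/
lemma exists_pos_le_of_dichotomy {e : ℕ → ℝ} {κ : ℝ} (hκ : 0 < κ) (hκ1 : κ ≤ 1) (h0 : ∀ n, 0 < e n)
    (h1 : ∀ n, e n ≤ 1) (hi : ∀ n, κ * e n ^ 2 ≤ e (n + 1))
    (hd : ∀ n, κ * e n ≤ e (n + 1) ^ 2 ∨ κ * e n ≤ e (n + 2) * (e n + e (n + 1))) :
    ∃ δ, 0 < δ ∧ ∀ n, δ ≤ e n := by
  set θ := min (κ ^ 9 / 8) (min (e 0) (e 1)) with hθ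
  have t0 : 0 < θ := lt_min (by positivity) (lt_min (h0 0) (h0 1))
  have t1 : θ ≤ κ ^ 9 / 8 := min_le_left _ _
  have te0 : θ ≤ e 0 := (min_le_right _ _).trans (min_le_left _ _)
  have te1 : θ ≤ e 1 := (min_le_right _ _).trans (min_le_right _ _)
  have tle : θ ≤ 1 := te0.trans (h1 0)
  have p3 : κ ^ 9 ≤ κ ^ 3 := pow_le_pow_of_le_one hκ.le hκ1 (by norm_num)
  have p1 : κ ^ 3 ≤ κ := by simpa using pow_le_pow_of_le_one hκ.le hκ1 (show 1 ≤ 3 by norm_num)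
  have k3 : 0 < κ ^ 3 := by positivity
  have k3' : κ ^ 3 ≤ 1 := p1.trans hκ1
  have q32 : θ ^ 3 ≤ θ := by simpa using pow_le_pow_of_le_one t0.le tle (show 1 ≤ 3 by norm_num)
  have q43 : θ ^ 4 ≤ θ ^ 3 := pow_le_pow_of_le_one t0.le tle (by norm_num)
  have q42 : θ ^ 4 ≤ θ * θ ^ 2 := by nlinarith [q43]
  have t4 : 0 < θ ^ 4 := by positivity
  have t3 : 0 < θ ^ 3 := by positivity
  have t2 : 0 < θ ^ 2 := by positivity
  have k34 : κ ^ 3 * θ ^ 4 ≤ θ ^ 4 := by nlinarith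
  let R : ℕ → Prop := fun n => κ ^ 3 * θ ^ 4 ≤ e n ∧
    (θ ^ 3 ≤ e n ∨ ∃ m, n = m + 1 ∧ κ * θ ^ 2 ≤ e m)
  have big : ∀ n, θ ^ 3 ≤ e n → R n := fun n h => ⟨by linarith, Or.inl h⟩
  have key : ∀ n, R n ∧ R (n + 1) := by
    intro n
    induction n with
    | zero => exact ⟨big _ (by linarith), big _ (by simpa using q32.trans te1)⟩
    | succ n ih =>
      obtain ⟨⟨a0, a1⟩, ih2⟩ := ih
      refine ⟨ih2, ?_⟩
      have hi1 := hi (n + 1)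
      have e0 := h0 n
      have e1 := h0 (n + 1)
      have e2 := h0 (n + 2)
      change κ * e (n + 1) ^ 2 ≤ e (n + 2) at hi1
      change R (n + 2)
      rcases hd n with low | high
      · by_cases hbig : θ ^ 4 ≤ e n
        · have hs : κ * θ ^ 2 ≤ e (n + 1) := by
            refine le_of_sq_le_sq ?_ e1.le
            have : κ ^ 2 * θ ^ 4 ≤ κ * θ ^ 4 := by nlinarith
            calc (κ * θ ^ 2) ^ 2 = κ ^ 2 * θ ^ 4 := by ring
              _ ≤ κ * θ ^ 4 := this
              _ ≤ κ * e n := by gcongr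
              _ ≤ _ := low
          refine ⟨le_trans ?_ hi1, Or.inr ⟨n + 1, rfl, hs⟩⟩
          calc κ ^ 3 * θ ^ 4 = κ * (κ * θ ^ 2) ^ 2 := by ring
            _ ≤ _ := by gcongr
        · push Not at hbig
          obtain ⟨m, rfl, hm⟩ := a1.resolve_left (by linarith)
          have em := h0 m
          have hsm : e (m + 1) ≤ e m := by nlinarith
          rcases hd m with low' | high'
          · exfalso
            have s1 : e (m + 1) ^ 2 ≤ (θ ^ 4) ^ 2 := by gcongr
            have s2 : κ * (κ * θ ^ 2) ≤ κ * e m := by gcongr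
            have s3 : θ ^ 6 ≤ θ := by
              simpa using pow_le_pow_of_le_one t0.le tle (show 1 ≤ 6 by norm_num)
            have s4 : κ ^ 9 ≤ κ ^ 2 := pow_le_pow_of_le_one hκ.le hκ1 (by norm_num)
            have s5 : (θ ^ 4) ^ 2 = θ ^ 6 * θ ^ 2 := by ring
            have s6 : κ ^ 2 * θ ^ 2 ≤ θ ^ 6 * θ ^ 2 := by nlinarith
            have s7 := le_of_mul_le_mul_right s6 t2
            have : 0 < κ ^ 9 := by positivity
            linarith
          · have hs : κ / 2 ≤ e (m + 2) := by
              have e2' := h0 (m + 2)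
              have : κ * e m ≤ e (m + 2) * (2 * e m) := high'.trans (by gcongr; linarith)
              nlinarith
            refine big _ (le_trans ?_ hi1)
            have s1 : (κ / 2) ^ 2 ≤ e (m + 2) ^ 2 := by gcongr
            have s2 : κ * (κ / 2) ^ 2 ≤ κ * e (m + 2) ^ 2 := by gcongr
            change θ ^ 3 ≤ κ * e (m + 2) ^ 2
            nlinarith
      · apply big
        by_contra! hsm
        rcases le_total (e (n + 1)) (e n) with h | h
        · have : κ * e n ≤ e (n + 2) * (2 * e n) := high.trans (by gcongr; linarith)
          have : κ / 2 ≤ e (n + 2) := by nlinarith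
          linarith
        · have s1 : κ * e n ≤ θ ^ 3 * (2 * e (n + 1)) := high.trans (by gcongr; linarith)
          have s2 : κ * (κ ^ 3 * θ ^ 4) ≤ θ ^ 3 * (2 * e (n + 1)) :=
            le_trans (by gcongr) s1
          have s3 : κ ^ 4 * θ / 2 ≤ e (n + 1) := by
            have : θ ^ 3 * (κ ^ 4 * θ) ≤ θ ^ 3 * (2 * e (n + 1)) := by linarith
            have := le_of_mul_le_mul_left this t3
            linarith
          have s4 : κ * (κ ^ 4 * θ / 2) ^ 2 < θ ^ 3 := by
            refine lt_of_le_of_lt ?_ hsm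
            refine le_trans ?_ hi1
            gcongr
          have s5 : κ ^ 9 / 4 * θ ^ 2 < θ * θ ^ 2 := by linarith
          have := lt_of_mul_lt_mul_right s5 t2.le
          have : 0 < κ ^ 9 := by positivity
          linarith
  exact ⟨κ ^ 3 * θ ^ 4, by positivity, fun n => (key n).1.1⟩

namespace NestData

/-- The configuration of a non-central return: `h` is the branch around the critical value along the
first return to `I^{n+1}`, extended over `I^n` to an interval with endpoints `ξ` and `ξ'`. -/
lemma exists_return_points (D : NestData f a b c J l u r) (hf : IsQuasiQuadratic f a b c)
    (hA : Comparable f c l u A) (hnc : ∀ n, f^[r n] c ∉ Ioo (l (n + 1)) (u (n + 1))) (n : ℕ)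
    {h : ℝ → ℝ} (hh : h = f^[r (n + 1) - 1]) :
    ∃ ξ₁ ξ₂ ξ ξ', IsBranch f a b c (r (n + 1) - 1) ξ₁ ξ₂ (l n) (u n) ∧
      ξ ∈ Icc ξ₁ ξ₂ ∧ ξ' ∈ Icc ξ₁ ξ₂ ∧
      ((ξ < f (l (n + 2)) ∧ f (l (n + 2)) < f (l (n + 3)) ∧ f (l (n + 3)) < f c ∧ f c < ξ') ∨
      (ξ' < f c ∧ f c < f (l (n + 3)) ∧ f (l (n + 3)) < f (l (n + 2)) ∧ f (l (n + 2)) < ξ)) ∧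
      ((h ξ = l n ∧ h ξ' = u n ∧ h (f (l (n + 2))) = l (n + 1)) ∨
        (h ξ = u n ∧ h ξ' = l n ∧ h (f (l (n + 2))) = u (n + 1))) ∧
      |f (l (n + 2)) - ξ| ≤ |f (l (n + 1)) - f c| - |f (l (n + 2)) - f c| ∧
      h (f c) ∈ Ioo (l (n + 1)) (u (n + 1)) ∧
      h (f (l (n + 3))) ∈ Icc (l (n + 1)) (u (n + 1)) ∧
      ((h (f c) ≤ l (n + 2) ∧ h (f (l (n + 3))) ≤ l (n + 2)) ∨
        (u (n + 2) ≤ h (f c) ∧ u (n + 2) ≤ h (f (l (n + 3))))) := by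
  have cl := (D.crit_mem (n + 2)).1
  have cu := (D.crit_mem (n + 2)).2
  obtain ⟨ξ₁, ξ₂, hcξ, hB⟩ := D.exists_extension hf n
  obtain ⟨x₁, y₁, hx1, -, hy1, hJ1, -, hm⟩ := hB.exists_sub hf (D.lt_left n) (D.lt (n + 1))
    (D.lt_right n)
  have hv : f^[r (n + 1) - 1] (f c) ∈ Ioo (l (n + 1)) (u (n + 1)) := by
    rw [D.iterate_pred]; exact (D.first (n + 1)).2.1
  have hv' : f^[r (n + 1) - 1] (f c) ∉ Ioo (l (n + 2)) (u (n + 2)) := by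
    rw [D.iterate_pred]; exact hnc (n + 1)
  have hc1 : f c ∈ Ioo x₁ y₁ := hm _ hcξ hv
  obtain ⟨x₀, y₀, hc0, hJ0, he0, -⟩ := D.branch n
  obtain ⟨x₁', y₁', hc1', hJ1', he1, -⟩ := D.branch (n + 1)
  obtain ⟨x₂, y₂, hc2, hJ2, he2, -⟩ := D.branch (n + 2)
  change f (l (n + 2)) = x₁' ∨ f (l (n + 2)) = y₁' at he1
  change f (l (n + 3)) = x₂ ∨ f (l (n + 3)) = y₂ at he2
  have s01 := hB.subset_of_notMem hf hcξ hc0 (D.branch_ends hf hJ0 hc0 _ (by simp))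
    (D.branch_ends hf hJ0 hc0 _ (by simp))
  have s11 := hJ1'.subset_of_notMem hf hc1' hc1 (D.branch_ends hf hJ1 hc1 _ (by simp))
    (D.branch_ends hf hJ1 hc1 _ (by simp))
  have s11' := hJ1.subset_of_notMem hf hc1 hc1' (D.branch_ends hf hJ1' hc1' _ (by simp))
    (D.branch_ends hf hJ1' hc1' _ (by simp))
  obtain rfl : x₁ = x₁' := le_antisymm s11.1 s11'.1
  obtain rfl : y₁ = y₁' := le_antisymm s11'.2 s11.2
  have rlt : r (n + 1) < r (n + 2) := D.r_lt (n + 1)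
  have r1 := D.one_le_r (n + 1)
  have s12 := hJ2.subset_of_notMem hf hc2 hc1
    (fun h => D.branch_ends hf hJ1 hc1 _ (by simp) (D.Ioo_subset (n + 1).le_succ h))
    (fun h => D.branch_ends hf hJ1 hc1 _ (by simp) (D.Ioo_subset (n + 1).le_succ h))
  have av : ∀ w ∈ Icc x₂ y₂, f^[r (n + 1) - 1] w ∉ Ioo (l (n + 2)) (u (n + 2)) := fun w hw =>
    hJ2.avoid hf (by omega) hc2 hv' ((D.isNice (n + 2)).nice_ends (by omega) (by simp))
      ((D.isNice (n + 2)).nice_ends (by omega) (by simp)) hw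
  rw [← hh] at hv hv' av
  have hcont : ContinuousOn h (Icc x₂ y₂) :=
    hh ▸ (hf.continuousOn_iterate _).mono hJ2.subset_Icc
  have mc2 := Ioo_subset_Icc_self hc2
  have sameL : h (f c) ≤ l (n + 2) → ∀ w ∈ Icc x₂ y₂, h w ≤ l (n + 2) := by
    intro hle w hw
    by_contra! hcon
    have hge : u (n + 2) ≤ h w := by
      by_contra! h'
      exact av w hw ⟨hcon, h'⟩
    obtain ⟨z, hz, ez⟩ := isPreconnected_Icc.intermediate_value mc2 hw hcont
      (show c ∈ Icc _ _ from ⟨by linarith, by linarith⟩)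
    exact av z hz (ez ▸ ⟨cl, cu⟩)
  have sameU : u (n + 2) ≤ h (f c) → ∀ w ∈ Icc x₂ y₂, u (n + 2) ≤ h w := by
    intro hge w hw
    by_contra! hcon
    have hle : h w ≤ l (n + 2) := by
      by_contra! h'
      exact av w hw ⟨h', hcon⟩
    obtain ⟨z, hz, ez⟩ := isPreconnected_Icc.intermediate_value hw mc2 hcont
      (show c ∈ Icc _ _ from ⟨by linarith, by linarith⟩)
    exact av z hz (ez ▸ ⟨cl, cu⟩)
  have mem : ∀ k, l k ∈ Icc a b := fun k => by
    have := (D.isNice k).left_mem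
    exact ⟨this.1.le, (this.2.trans hf.crit_mem.2).le⟩
  have ne : ∀ k, l k ≠ c := fun k => (D.crit_mem k).1.ne
  have hvs : h (f c) ≤ l (n + 2) ∨ u (n + 2) ≤ h (f c) := by
    by_contra! hcon
    exact hv' hcon
  have fin : ∀ w ∈ Icc x₂ y₂, h w ∈ Icc (l (n + 1)) (u (n + 1)) ∧
      ((h (f c) ≤ l (n + 2) ∧ h w ≤ l (n + 2)) ∨ (u (n + 2) ≤ h (f c) ∧ u (n + 2) ≤ h w)) := by
    intro w hw
    refine ⟨?_, hvs.imp (fun k => ⟨k, sameL k w hw⟩) fun k => ⟨k, sameU k w hw⟩⟩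
    have hmem : w ∈ Icc x₁ y₁ := Icc_subset_Icc s12.1 s12.2 hw
    have hx : x₁ ∈ Icc x₁ y₁ := ⟨le_rfl, hJ1.lt.le⟩
    have hy : y₁ ∈ Icc x₁ y₁ := ⟨hJ1.lt.le, le_rfl⟩
    rw [hh]
    rcases hJ1.strict hf with ⟨m, e1, e2⟩ | ⟨m, e1, e2⟩
    · rw [← e1, ← e2]
      exact ⟨m.monotoneOn hx hmem hmem.1, m.monotoneOn hmem hy hmem.2⟩
    · rw [← e1, ← e2]
      exact ⟨m.antitoneOn hmem hy hmem.2, m.antitoneOn hx hmem hmem.1⟩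
  have lt23 : radius f c l (n + 3) ^ 2 < radius f c l (n + 2) ^ 2 :=
    pow_lt_pow_left₀ (hA.lt (n + 2)) (hA.pos _).le two_ne_zero
  rw [sq_radius, sq_radius] at lt23
  have ends : (h ξ₁ = l n ∧ h ξ₂ = u n ∧ h x₁ = l (n + 1) ∧ h y₁ = u (n + 1)) ∨
      (h ξ₁ = u n ∧ h ξ₂ = l n ∧ h x₁ = u (n + 1) ∧ h y₁ = l (n + 1)) := by
    rw [hh]
    rcases hB.strict hf with ⟨m, e1, e2⟩ | ⟨m, e1, e2⟩
    · have := m ⟨hx1.le, (hJ1.lt.trans hy1).le⟩ ⟨(hx1.trans hJ1.lt).le, hy1.le⟩ hJ1.lt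
      have e := hJ1.ends.resolve_right (by
        rintro ⟨e1, e2⟩; linarith [D.lt (n + 1)])
      exact Or.inl ⟨e1, e2, e⟩
    · have := m ⟨hx1.le, (hJ1.lt.trans hy1).le⟩ ⟨(hx1.trans hJ1.lt).le, hy1.le⟩ hJ1.lt
      have e := hJ1.ends.resolve_left (by
        rintro ⟨e1, e2⟩; linarith [D.lt (n + 1)])
      exact Or.inr ⟨e1, e2, e⟩
  have mξ₁ : ξ₁ ∈ Icc ξ₁ ξ₂ := ⟨le_rfl, hB.lt.le⟩
  have mξ₂ : ξ₂ ∈ Icc ξ₁ ξ₂ := ⟨hB.lt.le, le_rfl⟩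
  rcases hf.critical_value_extremal with ext | ext
  · have i1 := ext _ (mem (n + 1)) (ne _)
    have i2 := ext _ (mem (n + 2)) (ne _)
    have i3 := ext _ (mem (n + 3)) (ne _)
    have k0 : f (l (n + 1)) = x₀ := he0.resolve_right (by intro h; linarith [hc0.2])
    have k1 : f (l (n + 2)) = x₁ := he1.resolve_right (by intro h; linarith [hc1.2])
    have k2 : f (l (n + 3)) = x₂ := he2.resolve_right (by intro h; linarith [hc2.2])
    rw [k0] at i1
    rw [k1] at i2
    rw [k2] at i3
    rw [k1, k2, abs_of_neg (by linarith), abs_of_neg (by linarith)] at lt23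
    refine ⟨ξ₁, ξ₂, ξ₁, ξ₂, hB, mξ₁, mξ₂, Or.inl ?_, ?_, ?_, hv, k2 ▸ fin x₂ ⟨le_rfl, hJ2.lt.le⟩⟩
    · rw [k1, k2]; exact ⟨hx1, by linarith, i3, hcξ.2⟩
    · rw [k1]
      rcases ends with ⟨e1, e2, e3, e4⟩ | ⟨e1, e2, e3, e4⟩
      exacts [Or.inl ⟨e1, e2, e3⟩, Or.inr ⟨e1, e2, e3⟩]
    · rw [k0, k1, abs_of_pos (by linarith), abs_of_neg (by linarith), abs_of_neg (by linarith)]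
      linarith
  · have i1 := ext _ (mem (n + 1)) (ne _)
    have i2 := ext _ (mem (n + 2)) (ne _)
    have i3 := ext _ (mem (n + 3)) (ne _)
    have k0 : f (l (n + 1)) = y₀ := he0.resolve_left (by intro h; linarith [hc0.1])
    have k1 : f (l (n + 2)) = y₁ := he1.resolve_left (by intro h; linarith [hc1.1])
    have k2 : f (l (n + 3)) = y₂ := he2.resolve_left (by intro h; linarith [hc2.1])
    rw [k0] at i1
    rw [k1] at i2
    rw [k2] at i3
    rw [k1, k2, abs_of_pos (by linarith), abs_of_pos (by linarith)] at lt23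
    refine ⟨ξ₁, ξ₂, ξ₂, ξ₁, hB, mξ₂, mξ₁, Or.inr ?_, ?_, ?_, hv, k2 ▸ fin y₂ ⟨hJ2.lt.le, le_rfl⟩⟩
    · rw [k1, k2]; exact ⟨hcξ.1, i3, by linarith, hy1⟩
    · rw [k1]
      rcases ends with ⟨e1, e2, e3, e4⟩ | ⟨e1, e2, e3, e4⟩
      exacts [Or.inr ⟨e2, e1, e4⟩, Or.inl ⟨e2, e1, e4⟩]
    · rw [k0, k1, abs_of_neg (by linarith), abs_of_pos (by linarith), abs_of_pos (by linarith)]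
      linarith

/-- Cross-ratio estimates for a low and for a high return. -/
lemma low_or_high (D : NestData f a b c J l u r) (hf : IsQuasiQuadratic f a b c)
    (hA : Comparable f c l u A) (hnc : ∀ n, f^[r n] c ∉ Ioo (l (n + 1)) (u (n + 1))) (n : ℕ)
    {Q d₀ d₁ : ℝ} (hd₀ : d₀ = radius f c l n - radius f c l (n + 1))
    (hd₁ : d₁ = radius f c l (n + 1) - radius f c l (n + 2))
    (hQ : Q = (1 + A * d₁ / (d₀ / A)) * (1 + A * d₁ / (radius f c l (n + 2) / A))) :
    radius f c l (n + 1) ^ 2 ≤ (radius f c l (n + 1) ^ 2 - radius f c l (n + 2) ^ 2) * Q ∨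
    radius f c l (n + 2) ^ 2 ≤ (radius f c l (n + 2) ^ 2 - radius f c l (n + 3) ^ 2) * Q := by
  have hA0 : 0 < A := one_pos.trans_le hA.one_le
  have d0 : 0 < d₀ / A := div_pos (by rw [hd₀]; linarith [hA.lt n]) hA0
  have ρ2 : 0 < radius f c l (n + 2) / A := div_pos (hA.pos _) hA0
  have gl : d₀ / A ≤ l (n + 1) - l n := by
    rw [div_le_iff₀ hA0, hd₀]; linarith [hA.le_left_gap n]
  have gu : d₀ / A ≤ u n - u (n + 1) := by
    rw [div_le_iff₀ hA0, hd₀]; linarith [hA.le_right_gap n]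
  have hl2 : radius f c l (n + 2) / A ≤ c - l (n + 2) := by
    rw [div_le_iff₀ hA0]; linarith [hA.le_left (n + 2)]
  have hu2 : radius f c l (n + 2) / A ≤ u (n + 2) - c := by
    rw [div_le_iff₀ hA0]; linarith [hA.le_right (n + 2)]
  have gl' : l (n + 2) - l (n + 1) ≤ A * d₁ := by rw [hd₁]; exact hA.left_gap_le (n + 1)
  have gu' : u (n + 1) - u (n + 2) ≤ A * d₁ := by rw [hd₁]; exact hA.right_gap_le (n + 1)
  have cl := (D.crit_mem (n + 2)).1
  have cu := (D.crit_mem (n + 2)).2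
  have l01 := D.lt_left n
  have l12 : l (n + 1) < l (n + 2) := D.lt_left (n + 1)
  have u01 := D.lt_right n
  have u12 : u (n + 2) < u (n + 1) := D.lt_right (n + 1)
  obtain ⟨h, hh⟩ : ∃ h, h = f^[r (n + 1) - 1] := ⟨_, rfl⟩
  obtain ⟨ξ₁, ξ₂, ξ, ξ', hB, mξ, mξ', hord, hη, hξle, hv, hw12, hvs⟩ :=
    D.exists_return_points hf hA hnc n hh
  have hexp := @IsBranch.crossRatio_le _ _ _ _ _ _ _ _ _ hB hf
  rw [← hh] at hexp
  have low : |h (f c) - h (f (l (n + 2)))| ≤ A * d₁ →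
      d₀ / A ≤ |h (f (l (n + 2))) - h ξ| → radius f c l (n + 2) / A ≤ |h ξ' - h (f c)| →
      radius f c l (n + 1) ^ 2 ≤ (radius f c l (n + 1) ^ 2 - radius f c l (n + 2) ^ 2) * Q := by
    intro hg hU hV
    have ho : Ordered ξ (f (l (n + 2))) (f c) ξ' := by
      rcases hord with ⟨i, j, k, m⟩ | ⟨i, j, k, m⟩
      · exact Or.inl ⟨i, by linarith, m⟩
      · exact Or.inr ⟨i, by linarith, m⟩
    have k1 := (hexp ho mξ mξ').trans (crossRatio_le_of_le d0 ρ2 hg hU hV)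
    rw [← hQ] at k1
    have k2 := add_le_mul_crossRatio (w₂ := f c) (w₃ := ξ')
      (by rcases hord with h | h <;> [exact h.1.ne'; exact h.2.2.2.ne]) hξle
    rw [abs_sub_comm (f c)] at k2
    have k3 : |f (l (n + 2)) - f c| < |f (l (n + 1)) - f c| := by
      rw [← sq_radius, ← sq_radius]
      exact pow_lt_pow_left₀ (hA.lt (n + 1)) (hA.pos _).le two_ne_zero
    have k4 := mul_le_mul_of_nonneg_left k1 (sub_nonneg.2 k3.le)
    rw [sq_radius, sq_radius]
    linarith
  have high : |h (f c) - h (f (l (n + 3)))| ≤ A * d₁ →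
      radius f c l (n + 2) / A ≤ |h (f (l (n + 3))) - h (f (l (n + 2)))| →
      d₀ / A ≤ |h ξ' - h (f c)| →
      radius f c l (n + 2) ^ 2 ≤ (radius f c l (n + 2) ^ 2 - radius f c l (n + 3) ^ 2) * Q := by
    intro hg hU hV
    have ho : Ordered (f (l (n + 2))) (f (l (n + 3))) (f c) ξ' := by
      rcases hord with ⟨i, j, k, m⟩ | ⟨i, j, k, m⟩
      · exact Or.inl ⟨j, k, m⟩
      · exact Or.inr ⟨i, j, k⟩
    have mη : f (l (n + 2)) ∈ Icc ξ₁ ξ₂ := by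
      rcases hord with ⟨i, j, k, m⟩ | ⟨i, j, k, m⟩ <;> constructor <;>
        linarith [mξ.1, mξ.2, mξ'.1, mξ'.2]
    have k1 := (hexp ho mη mξ').trans (crossRatio_le_of_le ρ2 d0 hg hU hV)
    rw [mul_comm, ← hQ] at k1
    have heq : |f (l (n + 3)) - f (l (n + 2))| =
        |f (l (n + 2)) - f c| - |f (l (n + 3)) - f c| := by
      rcases hord with ⟨i, j, k, m⟩ | ⟨i, j, k, m⟩
      · rw [abs_of_pos (by linarith), abs_of_neg (by linarith), abs_of_neg (by linarith)]; ring
      · rw [abs_of_neg (by linarith), abs_of_pos (by linarith), abs_of_pos (by linarith)]; ring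
    have k2 := add_le_mul_crossRatio (w₂ := f c) (w₃ := ξ')
      (by rcases hord with h | h <;> [exact h.2.1.ne'; exact h.2.2.1.ne]) heq.le
    rw [abs_sub_comm (f c)] at k2
    have k4 := mul_le_mul_of_nonneg_left k1 (heq ▸ abs_nonneg _ :
      0 ≤ |f (l (n + 2)) - f c| - |f (l (n + 3)) - f c|)
    rw [sq_radius, sq_radius]
    linarith
  rcases hη with ⟨e1, e2, e3⟩ | ⟨e1, e2, e3⟩ <;> rcases hvs with ⟨hs, hs'⟩ | ⟨hs, hs'⟩
  · left
    refine low ?_ ?_ ?_ <;> rw [abs_of_pos] <;> rw [e3] at * <;>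
      linarith [hv.1, hv.2]
  · right
    refine high ?_ ?_ ?_
    · rw [abs_le]; constructor <;> linarith [hv.1, hv.2, hw12.2]
    · rw [e3, abs_of_pos] <;> linarith
    · rw [e2, abs_of_pos] <;> linarith [hv.2]
  · right
    refine high ?_ ?_ ?_
    · rw [abs_le]; constructor <;> linarith [hv.1, hv.2, hw12.1]
    · rw [e3, abs_of_neg] <;> linarith
    · rw [e2, abs_of_neg] <;> linarith [hv.1]
  · left
    refine low ?_ ?_ ?_ <;> rw [abs_of_neg] <;> rw [e3] at * <;>
      linarith [hv.1, hv.2]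

end NestData

lemma le_of_low {T A x y : ℝ} (hT : 1 ≤ T) (hx : 0 < x) (hx1 : x ≤ 1) (hy : 0 < y)
    (hA : A ^ 2 ≤ T) (h : x ≤ 2 * y * ((x + A ^ 2 * y) * T)) : x ≤ 16 * T ^ 2 * y ^ 2 := by
  by_cases hs : 4 * (T * y) ≤ 1
  · have h2 : A ^ 2 * (T * y ^ 2) ≤ T * (T * y ^ 2) := by gcongr
    have h3 : x * (4 * (T * y)) ≤ x * 1 := by gcongr
    have h4 : 0 ≤ T * (T * y ^ 2) := by positivity
    linarith
  · have h2 : 1 ^ 2 ≤ (4 * (T * y)) ^ 2 := by gcongr; linarith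
    linarith

lemma le_of_high {T A x y z : ℝ} (hT : 1 ≤ T) (hx : 0 < x) (hy : 0 < y) (hz : 0 < z)
    (hA : A ^ 2 ≤ T) (h : x ≤ 2 * z * ((x + A ^ 2 * y) * T)) :
    x ≤ 16 * T ^ 2 * (z * (x + y)) := by
  have h1 : 1 * x ≤ T * x := by gcongr
  have h2 : A ^ 2 * y ≤ T * y := by gcongr
  have h3 : 2 * z * ((x + A ^ 2 * y) * T) ≤ 2 * z * ((T * x + T * y) * T) := by
    gcongr
    linarith
  have h4 : 0 ≤ T ^ 2 * (z * (x + y)) := by positivity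
  linarith

namespace NestData

/-- A priori bounds: without central returns, the Poincaré lengths `P(I^{n+1} | I^n)` are bounded. -/
lemma exists_crossRatio_le (D : NestData f a b c J l u r) (hf : IsQuasiQuadratic f a b c)
    (hA : Comparable f c l u A) (hnc : ∀ n, f^[r n] c ∉ Ioo (l (n + 1)) (u (n + 1))) :
    ∃ B, ∀ n, crossRatio (l n) (l (n + 1)) (u (n + 1)) (u n) ≤ B := by
  have hA1 := hA.one_le
  have hA0 : 0 < A := one_pos.trans_le hA1
  set ρ := radius f c l with hρ
  set e : ℕ → ℝ := fun n => 1 - ρ (n + 1) / ρ n with he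
  have hpos : ∀ n, 0 < ρ n := hA.pos
  have heρ : ∀ n, ρ (n + 1) = (1 - e n) * ρ n := fun n => by
    have := (hpos n).ne'
    simp only [he]; field_simp; ring
  have e0 : ∀ n, 0 < e n := fun n => by
    have := (div_lt_one (hpos n)).2 (hA.lt n)
    simp only [he]; linarith
  have e1 : ∀ n, e n < 1 := fun n => by
    have := div_pos (hpos (n + 1)) (hpos n)
    simp only [he]; linarith
  have hgap : ∀ n, ρ n - ρ (n + 1) = e n * ρ n := fun n => by rw [heρ]; ring
  have hsq : ∀ n, ρ n ^ 2 - ρ (n + 1) ^ 2 ≤ 2 * e n * ρ n ^ 2 := fun n => by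
    rw [heρ]
    nlinarith [mul_nonneg (sq_nonneg (e n)) (sq_nonneg (ρ n))]
  have hcr : ∀ n, crossRatio (l n) (l (n + 1)) (u (n + 1)) (u n) ≤ (1 + 2 * A ^ 2 / e n) ^ 2 := by
    intro n
    have hd : 0 < e n * ρ n / A := div_pos (mul_pos (e0 n) (hpos n)) hA0
    refine (crossRatio_le_of_le (g := 2 * A * ρ n) hd hd ?_ ?_ ?_).trans (le_of_eq ?_)
    · rw [abs_of_pos (by linarith [D.lt (n + 1)])]
      have := mul_le_mul_of_nonneg_left (hA.lt n).le hA0.le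
      linarith [hA.left_le (n + 1), hA.right_le (n + 1)]
    · rw [abs_of_pos (by linarith [D.lt_left n]), div_le_iff₀ hA0, ← hgap]
      linarith [hA.le_left_gap n]
    · rw [abs_of_pos (by linarith [D.lt_right n]), div_le_iff₀ hA0, ← hgap]
      linarith [hA.le_right_gap n]
    · have := (hpos n).ne'
      have := (e0 n).ne'
      field_simp
  have step : ∀ n, (2 * (1 + 2 * A ^ 2) ^ 2)⁻¹ * e n ^ 2 ≤ e (n + 1) := by
    intro n
    have h := D.sq_radius_le_crossRatio hf n
    have k1 : ρ (n + 1) ^ 2 * 1 ≤ ρ (n + 1) ^ 2 * (2 * e (n + 1) * (1 + 2 * A ^ 2 / e n) ^ 2) := by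
      rw [mul_one]
      refine h.trans ?_
      calc _ ≤ (2 * e (n + 1) * ρ (n + 1) ^ 2) * (1 + 2 * A ^ 2 / e n) ^ 2 := by
            have := e0 (n + 1)
            refine mul_le_mul (hsq (n + 1)) (hcr n)
              (zero_le_one.trans (one_le_crossRatio _ _ _ _)) (by positivity)
        _ = _ := by ring
    have k2 := le_of_mul_le_mul_left k1 (pow_pos (hpos _) 2)
    have k3 : 1 + 2 * A ^ 2 / e n ≤ (1 + 2 * A ^ 2) / e n := by
      rw [add_div]
      have : 1 ≤ 1 / e n := by rw [one_le_div (e0 n)]; exact (e1 n).le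
      linarith
    have k4 : 1 ≤ 2 * e (n + 1) * ((1 + 2 * A ^ 2) / e n) ^ 2 := by
      have := e0 (n + 1)
      have := e0 n
      exact k2.trans (by gcongr)
    rw [div_pow, ← mul_div_assoc, one_le_div (pow_pos (e0 n) 2)] at k4
    rw [inv_mul_le_iff₀ (by positivity)]
    linarith
  have dich : ∀ n, (16 * (1 + 2 * A ^ 2) ^ 2)⁻¹ * e n ≤ e (n + 1) ^ 2 ∨
      (16 * (1 + 2 * A ^ 2) ^ 2)⁻¹ * e n ≤ e (n + 2) * (e n + e (n + 1)) := by
    intro n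
    have x0 := e0 n
    have x1 := e0 (n + 1)
    have x2 := e0 (n + 2)
    have y0 := e1 n
    set T := 1 + 2 * A ^ 2 with hT
    have hT0 : 1 ≤ T := by rw [hT]; nlinarith
    by_cases hbig : 1 / 2 ≤ e (n + 1)
    · left
      rw [inv_mul_le_iff₀ (by positivity)]
      have k1 : 1 / 2 ≤ T * e (n + 1) := by nlinarith
      nlinarith
    push Not at hbig
    have hd : ρ (n + 1) - ρ (n + 2) = e (n + 1) * ρ (n + 1) := hgap (n + 1)
    have main := D.low_or_high hf hA hnc n rfl rfl rfl
    rw [← hρ, hgap n, hd] at main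
    set Q := (1 + A * (e (n + 1) * ρ (n + 1)) / (e n * ρ n / A)) *
      (1 + A * (e (n + 1) * ρ (n + 1)) / (ρ (n + 2) / A)) with hQ
    have hρ0 := hpos n
    have hρ1 := hpos (n + 1)
    have hρ2 := hpos (n + 2)
    have q1 : A * (e (n + 1) * ρ (n + 1)) / (e n * ρ n / A) ≤ A ^ 2 * e (n + 1) / e n := by
      rw [div_div_eq_mul_div, div_le_div_iff₀ (by positivity) (by positivity)]
      have := (hA.lt n).le
      rw [← hρ] at this
      calc A * (e (n + 1) * ρ (n + 1)) * A * e n = A ^ 2 * e (n + 1) * e n * ρ (n + 1) := by ring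
        _ ≤ A ^ 2 * e (n + 1) * e n * ρ n := by gcongr
        _ = _ := by ring
    have q2 : A * (e (n + 1) * ρ (n + 1)) / (ρ (n + 2) / A) ≤ A ^ 2 := by
      have h2 : ρ (n + 2) = (1 - e (n + 1)) * ρ (n + 1) := heρ (n + 1)
      rw [div_div_eq_mul_div, div_le_iff₀ hρ2, h2]
      calc A * (e (n + 1) * ρ (n + 1)) * A = A ^ 2 * (e (n + 1) * ρ (n + 1)) := by ring
        _ ≤ A ^ 2 * ((1 - e (n + 1)) * ρ (n + 1)) := by gcongr; linarith
    have hQle : Q ≤ (1 + A ^ 2 * e (n + 1) / e n) * T := by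
      rw [hQ, hT]
      gcongr
      nlinarith
    have hQ0 : 0 ≤ Q := by positivity
    have fin : ∀ k, ρ k ^ 2 ≤ (ρ k ^ 2 - ρ (k + 1) ^ 2) * Q →
        e n ≤ 2 * e k * ((e n + A ^ 2 * e (n + 1)) * T) := by
      intro k hk
      have hρk := hpos k
      have xk := e0 k
      have k1 : ρ k ^ 2 * 1 ≤ ρ k ^ 2 * (2 * e k * ((1 + A ^ 2 * e (n + 1) / e n) * T)) := by
        calc ρ k ^ 2 * 1 ≤ (ρ k ^ 2 - ρ (k + 1) ^ 2) * Q := by rw [mul_one]; exact hk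
          _ ≤ (2 * e k * ρ k ^ 2) * ((1 + A ^ 2 * e (n + 1) / e n) * T) :=
            mul_le_mul (hsq k) hQle hQ0 (by positivity)
          _ = _ := by ring
      have k2 := le_of_mul_le_mul_left k1 (by positivity)
      calc e n = e n * 1 := by ring
        _ ≤ e n * (2 * e k * ((1 + A ^ 2 * e (n + 1) / e n) * T)) := by gcongr
        _ = _ := by field_simp
    have hAT : A ^ 2 ≤ T := by rw [hT]; nlinarith
    rcases main with low | high
    · left
      have k := fin (n + 1) low
      rw [inv_mul_le_iff₀ (by positivity)]
      exact le_of_low hT0 (e0 n) (e1 n).le x1 hAT k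
    · right
      have k := fin (n + 2) high
      rw [inv_mul_le_iff₀ (by positivity)]
      exact le_of_high hT0 (e0 n) x1 x2 hAT k
  have hκ : (16 * (1 + 2 * A ^ 2) ^ 2)⁻¹ ≤ (2 * (1 + 2 * A ^ 2) ^ 2)⁻¹ := by
    gcongr; norm_num
  obtain ⟨δ, hδ, hle⟩ := exists_pos_le_of_dichotomy (e := e)
    (κ := (16 * (1 + 2 * A ^ 2) ^ 2)⁻¹) (by positivity)
    (inv_le_one_of_one_le₀ (by nlinarith [sq_nonneg (1 + 2 * A ^ 2), sq_nonneg A])) e0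
    (fun n => (e1 n).le) (fun n => le_trans (by gcongr) (step n)) dich
  refine ⟨(1 + 2 * A ^ 2 / δ) ^ 2, fun n => (hcr n).trans ?_⟩
  have h0 := e0 n
  have := hle n
  gcongr

end NestData

lemma IsFirstPassage.unique {S : Set ℝ} {s t : ℕ} (hs : IsFirstPassage f c S s)
    (ht : IsFirstPassage f c S t) : s = t := by
  rcases lt_trichotomy s t with h | h | h
  · exact absurd hs.2.1 (ht.2.2 s hs.1 h)
  · exact h
  · exact absurd ht.2.1 (hs.2.2 t ht.1 h)

lemma exists_first_return {T : Set ℝ} {z : ℝ} (h : ∃ t, 1 ≤ t ∧ f^[t] z ∈ T) :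
    ∃ t, 1 ≤ t ∧ f^[t] z ∈ T ∧ ∀ i, 1 ≤ i → i < t → f^[i] z ∉ T := by
  classical
  exact ⟨Nat.find h, (Nat.find_spec h).1, (Nat.find_spec h).2,
    fun s h1 hs hA => Nat.find_min h hs ⟨h1, hA⟩⟩

/-- A non-central component `(k₁, k₂)` of the domain of the first return map to `I^N`, with return
time `τ`. -/
structure IsReturnBranch (f : ℝ → ℝ) (a b c : ℝ) (l u : ℕ → ℝ) (N τ : ℕ) (k₁ k₂ : ℝ) : Prop where
  one_le : 1 ≤ τ
  isBranch : IsBranch f a b c τ k₁ k₂ (l N) (u N)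
  subset : Ioo k₁ k₂ ⊆ Ioo (l N) (u N)
  avoid : ∀ w ∈ Ioo k₁ k₂, ∀ i, 1 ≤ i → i < τ → f^[i] w ∉ Ioo (l N) (u N)
  disjoint : ∀ w ∈ Ioo k₁ k₂, w ∉ Ioo (l (N + 1)) (u (N + 1))
  ends : ∀ e ∈ ({k₁, k₂} : Set ℝ), ∀ i, 1 ≤ i → f^[i] e ∉ Ioo (l N) (u N)

namespace NestData

lemma exists_isReturnBranch (D : NestData f a b c J l u r) (hf : IsQuasiQuadratic f a b c) {N : ℕ}
    {K : Set ℝ} (hK : K ∈ levelIntervals f c J (N + 1)) (hc : c ∉ K) :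
    ∃ k₁ k₂ τ, K = Ioo k₁ k₂ ∧ IsReturnBranch f a b c l u N τ k₁ k₂ := by
  obtain ⟨t₀, hz, rfl⟩ := hK
  simp only [Nat.add_sub_cancel] at hz hc ⊢
  have hcomp : connectedComponentIn (returnDomain f (nest f c J N)) c =
      Ioo (l (N + 1)) (u (N + 1)) := D.nest_eq (N + 1)
  have hzc : f^[t₀] c ∉ Ioo (l (N + 1)) (u (N + 1)) := by
    intro hm
    rw [← hcomp] at hm
    rw [← connectedComponentIn_eq hm, hcomp] at hc
    exact hc (D.crit_mem _)
  set z := f^[t₀] c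
  rw [D.nest_eq] at hz hc ⊢
  obtain ⟨τ, h1, hτ, hfirst⟩ := exists_first_return hz.2
  have hzI : z ∈ Icc a b := Ioo_subset_Icc_self ((D.isNice N).subset (Ioo_subset_Icc_self hz.1))
  obtain ⟨k₁, k₂, hzk, hB⟩ := exists_isBranch hf (D.isNice N).subset hzI hτ fun i hi => by
    rcases Nat.eq_zero_or_pos i with rfl | hpos
    · obtain ⟨e, he, he'⟩ := exists_end_mem_uIcc (D.crit_mem (N + 1)) hzc
      exact ⟨e, he', D.avoid_ends N (by omega) he⟩
    · obtain ⟨e, he, he'⟩ := exists_end_mem_uIcc (D.crit_mem N) (hfirst i hpos hi)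
      exact ⟨e, he', (D.isNice N).nice_ends (by omega) he⟩
  have hsub := hB.subset_of_notMem hf hzk hz.1 ((D.isNice N).nice_ends h1 (by simp))
    ((D.isNice N).nice_ends h1 (by simp))
  refine ⟨k₁, k₂, τ, (D.isNice N).connectedComponentIn_eq hf hB hzk h1 hz.1 hfirst, h1, hB,
    Ioo_subset_Ioo hsub.1 hsub.2, fun w hw i hi hiτ => ?_, fun w hw => ?_, fun e he i hi => ?_⟩
  · exact hB.avoid hf hiτ.le hzk (hfirst i hi hiτ) ((D.isNice N).nice_ends (by omega) (by simp))
      ((D.isNice N).nice_ends (by omega) (by simp)) (Ioo_subset_Icc_self hw)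
  · exact hB.avoid hf (Nat.zero_le _) hzk hzc (D.avoid_ends N (by omega) (by simp))
      (D.avoid_ends N (by omega) (by simp)) (Ioo_subset_Icc_self hw)
  · exact (D.isNice N).branch_ends_notMem hf hB hzk hfirst hi he

/-- Before the first passage of `c` through a non-central interval `(k₁, k₂)`, the boundary of the
deeper intervals of the nest does not visit it either. -/
lemma iterate_left_notMem (D : NestData f a b c J l u r) (hf : IsQuasiQuadratic f a b c) {N τ t : ℕ}
    {k₁ k₂ : ℝ} (hK : IsReturnBranch f a b c l u N τ k₁ k₂)
    (ht : ∀ s, 1 ≤ s → s < t → f^[s] c ∉ Ioo k₁ k₂) (d : ℕ) {m : ℕ} (hm1 : 1 ≤ m) (hmt : m < t) :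
    f^[m] (l (N + d)) ∉ Ioo k₁ k₂ := by
  induction d generalizing m with
  | zero => exact fun h => (D.isNice N).nice m hm1 (hK.subset h)
  | succ d ih =>
    intro hm
    change f^[m] (l (N + d + 1)) ∈ _ at hm
    set j := N + d with hj
    have hNj : N ≤ j := by omega
    rcases lt_trichotomy m (r j) with hlt | heq | hgt
    · obtain ⟨k, hk, hk'⟩ := exists_end_mem_uIcc hm (ht m hm1 hmt)
      have hlc := (D.crit_mem (j + 1)).1
      obtain ⟨w, hw, rfl⟩ := intermediate_value_uIcc ((hf.continuousOn_iterate m).mono (by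
        rw [uIcc_of_le hlc.le]
        exact (Icc_subset_Icc (D.isNice _).left_mem.1.le hf.crit_mem.2.le))) hk'
      rw [uIcc_of_le hlc.le] at hw
      have hne : w ≠ l (j + 1) := by
        rintro rfl
        rcases hk with h | h
        · exact lt_irrefl _ (h ▸ hm.1)
        · exact lt_irrefl _ (mem_singleton_iff.1 h ▸ hm.2)
      have hwI : w ∈ Ioo (l (j + 1)) (u (j + 1)) :=
        ⟨lt_of_le_of_ne hw.1 hne.symm, hw.2.trans_lt (D.crit_mem _).2⟩
      have h1 := D.Ioo_subset hNj (D.apply_mem hf hwI)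
      have h2 := hK.ends _ hk (r j - m) (by omega)
      rw [← Function.iterate_add_apply, Nat.sub_add_cancel hlt.le] at h2
      exact h2 h1
    · have he := D.apply_end j
      rw [← heq] at he
      have hIcc : f^[m] (l (j + 1)) ∈ Icc (l j) (u j) := by
        rcases he with h | h
        · rw [h]; exact ⟨le_rfl, (D.lt j).le⟩
        · rw [mem_singleton_iff.1 h]; exact ⟨(D.lt j).le, le_rfl⟩
      rcases Nat.eq_zero_or_pos d with rfl | hd
      · have := hK.subset hm
        rcases he with h | h
        · rw [h] at this; exact lt_irrefl _ this.1
        · rw [mem_singleton_iff.1 h] at this; exact lt_irrefl _ this.2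
      · have hdis : Disjoint (Ioo k₁ k₂) (closure (Ioo (l (N + 1)) (u (N + 1)))) :=
          (disjoint_left.2 hK.disjoint).closure_right isOpen_Ioo
        rw [closure_Ioo (D.lt _).ne] at hdis
        exact disjoint_left.1 hdis hm (Icc_subset_Icc (D.monotone_l (by omega))
          (D.antitone_u (by omega)) hIcc)
    · have he := D.apply_end j
      have h1 := ih (m := m - r j) (by omega) (by have := D.one_le_r j; omega)
      have h2 : f^[m - r j] (f^[r j] (l (j + 1))) = f^[m - r j] (l j) := by
        rcases he with h | h
        · rw [h]
        · rw [mem_singleton_iff.1 h, iterate_eq_of_eq (D.isNice j).symm (by omega)]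
      rw [← Function.iterate_add_apply, Nat.sub_add_cancel hgt.le] at h2
      rw [h2] at hm
      exact h1 hm

/-- The landing branch over `I^{N+d+1}` is exponentially small in `I^N`. -/
lemma exists_landing (D : NestData f a b c J l u r) (hf : IsQuasiQuadratic f a b c) {E σ : ℝ}
    (hE : 1 ≤ E) (hσ : σ = E / (1 + E))
    (hcr : ∀ n, crossRatio (l n) (l (n + 1)) (u (n + 1)) (u n) ≤ E) {N : ℕ} {z : ℝ}
    (hz : z ∈ Ioo (l N) (u N)) (d : ℕ) {t : ℕ} (ht : f^[t] z ∈ Ioo (l (N + d + 1)) (u (N + d + 1)))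
    (hfirst : ∀ i < t, f^[i] z ∉ Ioo (l (N + d + 1)) (u (N + d + 1))) :
    ∃ x y, z ∈ Ioo x y ∧ IsBranch f a b c t x y (l (N + d + 1)) (u (N + d + 1)) ∧
      y - x ≤ (E - 1) * σ ^ d * (x - l N) ∧ y - x ≤ (E - 1) * σ ^ d * (u N - y) := by
  have hzI : z ∈ Icc a b := Ioo_subset_Icc_self ((D.isNice N).subset (Ioo_subset_Icc_self hz))
  have hσ0 : 0 < σ := by rw [hσ]; positivity
  obtain ⟨x₁, y₁, hz₁, hB₁⟩ := D.exists_branch_of_avoid hf hzI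
    (D.Ioo_subset (N + d).le_succ ht) hfirst
  obtain ⟨x, y, hx, hxy, hy, hB, hc, hm⟩ := hB₁.exists_sub hf (D.lt_left _) (D.lt _) (D.lt_right _)
  have hU := add_le_mul_crossRatio (w₂ := y) (w₃ := y₁) hx.ne' le_rfl
  have hV := add_le_mul_crossRatio (w₂ := x) (w₃ := x₁) hy.ne le_rfl
  rw [crossRatio_reverse] at hV
  rw [abs_of_pos (by linarith), abs_of_pos (by linarith)] at hU
  rw [abs_of_neg (by linarith), abs_of_neg (by linarith)] at hV
  have hcE := hc.trans (hcr (N + d))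
  have gU : y - x ≤ (E - 1) * (x - x₁) := by
    have := mul_le_mul_of_nonneg_left hcE (by linarith : 0 ≤ x - x₁)
    linarith
  have gV : y - x ≤ (E - 1) * (y₁ - y) := by
    have := mul_le_mul_of_nonneg_left hcE (by linarith : 0 ≤ -(y - y₁))
    linarith
  refine ⟨x, y, hm z hz₁ ht, hB, ?_⟩
  clear hm hB hfirst ht
  cases d with
  | zero =>
    have hend : ∀ e ∈ ({l N, u N} : Set ℝ), f^[t] e ∉ Ioo (l N) (u N) := by
      intro e he
      rcases Nat.eq_zero_or_pos t with rfl | ht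
      · rcases he with rfl | rfl
        · exact fun h => lt_irrefl _ h.1
        · exact fun h => lt_irrefl _ h.2
      · exact (D.isNice N).nice_ends ht he
    have hsub := hB₁.subset_of_notMem hf hz₁ hz (hend _ (by simp)) (hend _ (by simp))
    rw [pow_zero, mul_one]
    constructor
    · exact gU.trans (mul_le_mul_of_nonneg_left (by linarith) (by linarith))
    · exact gV.trans (mul_le_mul_of_nonneg_left (by linarith) (by linarith))
  | succ d =>
    have hex : ∃ i, f^[i] z ∈ Ioo (l (N + d + 1)) (u (N + d + 1)) := ⟨t, by
      have := hB₁.mapsTo hf hz₁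
      exact this⟩
    classical
    obtain ⟨x', y', hz', hB', hl', hu'⟩ := exists_landing D hf hE hσ hcr hz d (Nat.find_spec hex)
      fun i hi => Nat.find_min hex hi
    have hend : ∀ e ∈ ({x', y'} : Set ℝ), f^[t] e ∉ Ioo (l (N + d + 1)) (u (N + d + 1)) :=
      fun e he => (D.isNice _).branch_ends_notMem hf hB' hz' (i₀ := 0)
        (fun i _ hi => Nat.find_min hex hi) t.zero_le he
    have hsub := hB₁.subset_of_notMem hf hz₁ hz' (hend _ (by simp)) (hend _ (by simp))
    have hshrink : y - x ≤ σ * (y' - x') := by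
      rw [hσ, div_mul_eq_mul_div, le_div_iff₀ (by positivity)]
      have h1 : 0 ≤ y' - y := by linarith
      have h2 : (E - 1) * (x - x₁) ≤ (E - 1) * (x - x') :=
        mul_le_mul_of_nonneg_left (by linarith) (by linarith)
      have h3 : E * (y - x) ≤ (E - 1) * ((x - x') + (y - x)) := by linarith
      have h4 : 0 ≤ (E - 1) * (y' - y) := mul_nonneg (by linarith) h1
      have h5 : E * (y - x) ≤ (E - 1) * (y' - x') := by linarith
      linarith
    have hco : 0 ≤ (E - 1) * σ ^ d := mul_nonneg (by linarith) (by positivity)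
    have e : (E - 1) * σ ^ (d + 1) = σ * ((E - 1) * σ ^ d) := by ring
    constructor
    · calc y - x ≤ σ * (y' - x') := hshrink
        _ ≤ σ * ((E - 1) * σ ^ d * (x' - l N)) := by gcongr
        _ ≤ σ * ((E - 1) * σ ^ d * (x - l N)) := by gcongr; linarith
        _ = _ := by rw [e]; ring
    · calc y - x ≤ σ * (y' - x') := hshrink
        _ ≤ σ * ((E - 1) * σ ^ d * (u N - y')) := by gcongr
        _ ≤ σ * ((E - 1) * σ ^ d * (u N - y)) := by gcongr; linarith
        _ = _ := by rw [e]; ring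
termination_by d

/-- The pull-back of a non-central interval `(k₁, k₂)` of level `N + 1` and rank `d + 2` along the
critical orbit, and the interval of level `N + d + 2` inside it. -/
lemma exists_deep_interval (D : NestData f a b c J l u r) (hf : IsQuasiQuadratic f a b c)
    (hrec : IsRecurrent f c) {E σ : ℝ} (hE : 1 ≤ E) (hσ : σ = E / (1 + E))
    (hcr : ∀ n, crossRatio (l n) (l (n + 1)) (u (n + 1)) (u n) ≤ E) {N τ d t : ℕ} {k₁ k₂ : ℝ}
    (hK : IsReturnBranch f a b c l u N τ k₁ k₂) (ht : IsFirstPassage f c (Ioo k₁ k₂) t)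
    (h1 : r (N + d + 1) ≤ t) (h2 : t < r (N + d + 2)) :
    ∃ m s x' y' x y, IsBranch f a b c m x' y' k₁ k₂ ∧
      Ioo x' y' ⊆ Ioo (l (N + d + 1)) (u (N + d + 1)) \ Ioo (l (N + d + 2)) (u (N + d + 2)) ∧
      f^[s] c ∈ returnDomain f (Ioo (l (N + d + 1)) (u (N + d + 1))) ∧
      connectedComponentIn (returnDomain f (Ioo (l (N + d + 1)) (u (N + d + 1)))) (f^[s] c) =
        Ioo x y ∧ x' < x ∧ x < y ∧ y < y' ∧
      crossRatio x' x y y' ≤ (1 + (E - 1) * σ ^ d) ^ 2 ∧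
      crossRatio (l (N + d + 1)) x y (u (N + d + 1)) ≤ crossRatio x' x y y' ∧
      radius f c l (N + d + 2) ^ 2 ≤ (radius f c l (N + d + 2) ^ 2 - radius f c l (N + d + 3) ^ 2) *
        crossRatio (l (N + d + 1)) x y (u (N + d + 1)) := by
  set M := N + d + 1 with hM
  change t < r (M + 1) at h2
  have hcI := Ioo_subset_Icc_self hf.crit_mem
  -- the last visit to `I^M` before the passage through the interval
  obtain ⟨s, hst, hsM, hslast⟩ : ∃ s ≤ t, f^[s] c ∈ Ioo (l M) (u M) ∧
      (r M ≤ s) ∧ ∀ i, s < i → i ≤ t → f^[i] c ∉ Ioo (l M) (u M) := by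
    classical
    have hP := Nat.findGreatest_spec (P := fun i => f^[i] c ∈ Ioo (l M) (u M)) h1 (D.first M).2.1
    exact ⟨_, Nat.findGreatest_le t, hP, Nat.le_findGreatest h1 (D.first M).2.1,
      fun i hi hit => Nat.findGreatest_is_greatest hi hit⟩
  obtain ⟨hrs, hslast⟩ := hslast
  have hs1 : 1 ≤ s := (D.one_le_r M).trans hrs
  have hne : s ≠ t := by
    rintro rfl
    exact hK.disjoint _ ht.2.1 (D.Ioo_subset (by omega) hsM)
  obtain ⟨m, hm⟩ : ∃ m, t = m + s := ⟨t - s, by omega⟩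
  have hm1 : 1 ≤ m := by omega
  set z := f^[s] c with hz
  have hzI : z ∈ Icc a b := hf.iterate_mem s hcI
  have hzm : f^[m] z = f^[t] c := by rw [hz, ← Function.iterate_add_apply, hm]
  have hkI : Icc k₁ k₂ ⊆ Ioo a b := hK.isBranch.subset
  obtain ⟨x', y', hzx', hB'⟩ := exists_isBranch hf hkI hzI (t := m) (by rw [hzm]; exact ht.2.1)
    fun i hi => ⟨c, left_mem_uIcc, ht.2.2 _ (by omega) (by omega)⟩
  have hnot : ∀ j, 1 ≤ j → ∀ e ∈ ({l (N + j), u (N + j)} : Set ℝ), f^[m] e ∉ Ioo k₁ k₂ := by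
    intro j _ e he
    have := D.iterate_left_notMem hf hK ht.2.2 j hm1 (by omega)
    rcases he with rfl | rfl
    · exact this
    · rwa [iterate_eq_of_eq (D.isNice _).symm hm1]
  have hin := hB'.subset_of_notMem hf hzx' hsM (hnot (d + 1) (by omega) _ (by simp [hM, add_assoc]))
    (hnot (d + 1) (by omega) _ (by simp [hM, add_assoc]))
  have hzM1 : z ∉ Ioo (l (M + 1)) (u (M + 1)) := D.notMem_of_lt hs1 (by omega)
  have hout : ∀ w ∈ Icc x' y', w ∉ Ioo (l (M + 1)) (u (M + 1)) := fun w hw =>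
    hB'.avoid hf m.zero_le hzx' hzM1 (hnot (d + 2) (by omega) _ (by simp [hM, add_assoc]))
      (hnot (d + 2) (by omega) _ (by simp [hM, add_assoc])) hw
  -- the landing of the orbit to `I^M` after the passage
  have hBτ := hB'.comp hK.isBranch hf
  set z₁ := f^[m + τ] z with hz₁
  have hz₁N : z₁ ∈ Ioo (l N) (u N) := hBτ.mapsTo hf hzx'
  have hex : ∃ i, f^[i] z₁ ∈ Ioo (l M) (u M) := by
    obtain ⟨T, hT, hTm⟩ := hrec.exists_ge isOpen_Ioo (D.crit_mem M) (m + τ + s)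
    refine ⟨T - (m + τ + s), ?_⟩
    rw [hz₁, hz, ← Function.iterate_add_apply, ← Function.iterate_add_apply]
    rwa [show T - (m + τ + s) + (m + τ) + s = T by omega]
  classical
  set v := Nat.find hex with hv
  have hvm : f^[v] z₁ ∈ Ioo (l M) (u M) := Nat.find_spec hex
  obtain ⟨x₂, y₂, hz₂, hB₂, hl₂, hu₂⟩ := D.exists_landing hf hE hσ hcr hz₁N d hvm
    fun i hi => Nat.find_min hex hi
  have hσ0 : 0 < σ := by rw [hσ]; positivity
  have hco : 0 ≤ (E - 1) * σ ^ d := mul_nonneg (by linarith) (by positivity)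
  have hl₂' : 0 < x₂ - l N := by
    by_contra! h
    have := mul_nonpos_of_nonneg_of_nonpos hco h
    linarith [hB₂.lt]
  have hu₂' : 0 < u N - y₂ := by
    by_contra! h
    have := mul_nonpos_of_nonneg_of_nonpos hco h
    linarith [hB₂.lt]
  obtain ⟨x, y, hx, hxy, hy, hBx, hcrx, hmx⟩ := hBτ.exists_sub hf (by linarith) hB₂.lt (by linarith)
  have hzxy : z ∈ Ioo x y := hmx z hzx' hz₂
  have hL := hBx.comp hB₂ hf
  have hret : ∀ i, 1 ≤ i → i < m + τ + v → f^[i] z ∉ Ioo (l M) (u M) := by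
    intro i hi hiv
    rcases le_or_gt i m with h | h
    · rw [hz, ← Function.iterate_add_apply]
      exact hslast _ (by omega) (by omega)
    rcases lt_or_ge i (m + τ) with h' | h'
    · have := hK.avoid _ (hB'.mapsTo hf hzx') (i - m) (by omega) (by omega)
      rw [← Function.iterate_add_apply, Nat.sub_add_cancel h.le] at this
      exact fun hh => this (D.Ioo_subset (by omega) hh)
    · have := Nat.find_min hex (m := i - (m + τ)) (by omega)
      rwa [hz₁, ← Function.iterate_add_apply, Nat.sub_add_cancel h'] at this
  have hone : 1 ≤ m + τ + v := by omega
  have hcomp := (D.isNice M).connectedComponentIn_eq hf hL hzxy hone hsM hret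
  have hcr' : crossRatio (l M) x y (u M) ≤ crossRatio x' x y y' := by
    unfold crossRatio
    have a1 : |x - x'| ≤ |x - l M| := by
      rw [abs_of_pos (by linarith), abs_of_pos (by linarith)]; linarith
    have a2 : |y' - y| ≤ |u M - y| := by
      rw [abs_of_pos (by linarith), abs_of_pos (by linarith)]; linarith
    have b1 : 0 < |x - x'| := abs_pos.2 (by linarith)
    have b2 : 0 < |y' - y| := abs_pos.2 (by linarith)
    gcongr
  refine ⟨m, s, x', y', x, y, hB', fun w hw => ⟨Ioo_subset_Ioo hin.1 hin.2 hw,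
    hout w (Ioo_subset_Icc_self hw)⟩, ⟨hsM, _, hone, hL.mapsTo hf hzxy⟩, hcomp, hx, hxy, hy, ?_, hcr',
    ?_⟩
  · refine hcrx.trans ?_
    rw [crossRatio, abs_of_pos hl₂', abs_of_pos hu₂', abs_of_pos (by linarith [hB₂.lt]), sq]
    have c1 : (y₂ - x₂) / (x₂ - l N) ≤ (E - 1) * σ ^ d := by rwa [div_le_iff₀ hl₂']
    have c2 : (y₂ - x₂) / (u N - y₂) ≤ (E - 1) * σ ^ d := by rwa [div_le_iff₀ hu₂']
    have := hB₂.lt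
    gcongr
  -- pull back to the critical value
  have hsc : f^[s - 1] (f c) = z := by
    rw [← Function.iterate_succ_apply, Nat.succ_eq_add_one, Nat.sub_add_cancel hs1]
  obtain ⟨ξ₁, ξ₂, hcξ, hX⟩ := D.exists_branch_of_avoid hf (n := M) (t := s - 1) (hf.mapsTo hcI)
    (by rw [hsc]; exact hsM) fun i hi => by
      rw [← Function.iterate_succ_apply]
      exact D.notMem_of_lt (by omega) (by omega)
  obtain ⟨η₁, η₂, hη₁, -, hη₂, hBη, hcη, hmη⟩ := hX.exists_sub hf (α' := x) (β' := y) (by linarith)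
    hxy (by linarith)
  have hcη' : f c ∈ Ioo η₁ η₂ := hmη _ hcξ (by rw [hsc]; exact hzxy)
  have key := D.sq_radius_le hf hη₁ hcη' hη₂ (fun e he hmem => ?_) hX
  · exact key.trans (mul_le_mul_of_nonneg_left hcη (sub_nonneg.2 (D.sq_radius_lt hf (M + 1)).le))
  · have hse : f^[s - 1] e ∈ ({x, y} : Set ℝ) := by
      simp only [mem_insert_iff, mem_singleton_iff] at he ⊢
      rcases hBη.ends with ⟨e1, e2⟩ | ⟨e1, e2⟩ <;> rcases he with rfl | rfl <;> tauto
    have := (D.isNice M).branch_ends_notMem hf hL hzxy hret (i := r (M + 1) - s) (by omega) hse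
    rw [← Function.iterate_add_apply, show r (M + 1) - s + (s - 1) = r (M + 1) - 1 by omega] at this
    exact this (D.Ioo_subset M.le_succ hmem)

end NestData

lemma rpow_half_eq_sqrt {σ : ℝ} (hσ : 0 ≤ σ) {k : ℕ} (hk : 1 ≤ k) :
    σ ^ (((k : ℝ) - 1) / 2) = √(σ ^ (k - 1)) := by
  rw [Real.sqrt_eq_rpow, ← Real.rpow_natCast_mul hσ, Nat.cast_sub hk, Nat.cast_one]
  congr 1
  ring

namespace NestData

lemma scalingFactor_le (D : NestData f a b c J l u r) (hA : Comparable f c l u A) (n : ℕ) :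
    scalingFactor f c J (n + 1) ≤ A ^ 2 * (radius f c l (n + 1) / radius f c l n) := by
  have hA0 : 0 < A := one_pos.trans_le hA.one_le
  have h0 := hA.pos n
  rw [scalingFactor, Nat.add_sub_cancel, D.nest_eq, D.nest_eq, len_Ioo (D.lt _), len_Ioo (D.lt _),
    div_le_iff₀ (by linarith [D.lt n])]
  have k1 : u (n + 1) - l (n + 1) ≤ 2 * A * radius f c l (n + 1) := by
    linarith [hA.left_le (n + 1), hA.right_le (n + 1)]
  have k2 : 2 * radius f c l n ≤ A * (u n - l n) := by linarith [hA.le_left n, hA.le_right n]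
  have h1 := hA.pos (n + 1)
  calc u (n + 1) - l (n + 1) ≤ 2 * A * radius f c l (n + 1) := k1
    _ = A * (radius f c l (n + 1) / radius f c l n) * (2 * radius f c l n) := by field_simp
    _ ≤ A * (radius f c l (n + 1) / radius f c l n) * (A * (u n - l n)) := by gcongr
    _ = _ := by ring

lemma exists_hasRank (D : NestData f a b c J l u r) {N : ℕ} {K : Set ℝ}
    (hK : K ∈ levelIntervals f c J (N + 1)) : ∃ k, HasRank f c J (N + 1) K k := by
  by_cases hc : c ∈ K
  · exact ⟨0, Or.inl ⟨hc, rfl⟩⟩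
  obtain ⟨t₀, hz, hKe⟩ := hK
  have hzK : f^[t₀] c ∈ K := hKe ▸ mem_connectedComponentIn hz
  have hsub : K ⊆ Ioo (l N) (u N) := by
    rw [hKe, Nat.add_sub_cancel, D.nest_eq]
    exact fun w hw => (connectedComponentIn_subset _ _ hw).1
  have ht₀ : 1 ≤ t₀ := by
    by_contra! h
    obtain rfl : t₀ = 0 := by omega
    exact hc hzK
  obtain ⟨t, ht⟩ := exists_isFirstPassage ⟨t₀, ht₀, hzK⟩
  have hrN : r N ≤ t := by
    by_contra! h
    exact D.notMem_of_lt ht.1 h (hsub ht.2.1)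
  classical
  have hlarge : t < r (t + 1) := Nat.lt_of_lt_of_le (Nat.lt_succ_self t) (D.strictMono_r.id_le _)
  have hNt : N ≤ t := (D.strictMono_r.id_le N).trans hrN
  set M := Nat.findGreatest (fun i => r i ≤ t) t with hM
  have hNM : N ≤ M := Nat.le_findGreatest hNt hrN
  have hMt : r M ≤ t := Nat.findGreatest_spec (P := fun i => r i ≤ t) hNt hrN
  have hM1 : t < r (M + 1) := by
    rcases le_or_gt (M + 1) t with h | h
    · exact not_le.1 (Nat.findGreatest_is_greatest (P := fun i => r i ≤ t) (Nat.lt_succ_self M) h)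
    · have : M = t := le_antisymm (Nat.findGreatest_le t) (by omega)
      rw [this]; exact hlarge
  refine ⟨M - N + 1, Or.inr ⟨hc, by omega, t, r M, r (M + 1), ht, ?_, ?_, hMt, hM1⟩⟩
  · rw [show N + 1 + (M - N + 1) - 2 = M by omega, D.nest_eq]
    exact D.first M
  · rw [show N + 1 + (M - N + 1) - 1 = M + 1 by omega, D.nest_eq]
    exact D.first (M + 1)

/-- Exponential smallness of the intervals and of the scaling factors related to intervals of large
rank. -/
lemma exists_rank_bound (D : NestData f a b c J l u r) (hf : IsQuasiQuadratic f a b c)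
    (hrec : IsRecurrent f c) {lam : ℝ}
    (hcr : ∀ n, crossRatio (l n) (l (n + 1)) (u (n + 1)) (u n) ≤ Real.exp lam) :
    ∃ C : ℝ, ∀ n : ℕ, 1 ≤ n → ∀ K ∈ levelIntervals f c J n,
      ∀ k : ℕ, 2 ≤ k → HasRank f c J n K k →
        (∃ (m : ℕ) (K' : Set ℝ), IsMonotonePullback f m K' K ∧
          K' ⊆ nest f c J (n + k - 2) \ nest f c J (n + k - 1) ∧
          ∃ L ∈ levelIntervals f c J (n + k - 1), closure L ⊆ K' ∧
            poincareLength L (nest f c J (n + k - 2)) ≤ poincareLength L K' ∧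
            poincareLength L K' ≤ C * sigmaBar lam ^ (k - 1)) ∧
        scalingFactor f c J (n + k) ≤ C * sigmaBar lam ^ (((k : ℝ) - 1) / 2) := by
  obtain ⟨A, hA⟩ := D.exists_comparable hf
  set E := Real.exp lam with hEdef
  have hE : 1 ≤ E := (one_le_crossRatio _ _ _ _).trans (hcr 0)
  set σ := sigmaBar lam with hσdef
  have hσ : σ = E / (1 + E) := rfl
  have hσ0 : 0 < σ := by rw [hσ]; positivity
  have hσ1 : σ ≤ 1 := by rw [hσ, div_le_one (by positivity)]; linarith
  have hη : 0 ≤ E - 1 := by linarith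
  set B := 2 * (E - 1) + (E - 1) ^ 2 with hB
  have hB0 : 0 ≤ B := by positivity
  set C₁ := 2 * (E - 1) / σ with hC₁
  set C₂ := A ^ 2 * √(B / σ) with hC₂
  have hC₁0 : 0 ≤ C₁ := by positivity
  have hC₂0 : 0 ≤ C₂ := by positivity
  refine ⟨C₁ + C₂, fun n hn K hK k hk hrank => ?_⟩
  obtain ⟨N, rfl⟩ : ∃ N, n = N + 1 := ⟨n - 1, by omega⟩
  obtain ⟨d, rfl⟩ : ∃ d, k = d + 2 := ⟨k - 2, by omega⟩
  obtain ⟨hc, -, t, r₁, r₂, ht, hr₁, hr₂, h1, h2⟩ := hrank.resolve_left (by rintro ⟨-, h⟩; omega)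
  have i1 : N + 1 + (d + 2) - 2 = N + d + 1 := by omega
  have i2 : N + 1 + (d + 2) - 1 = N + d + 2 := by omega
  have i3 : N + 1 + (d + 2) = N + d + 2 + 1 := by omega
  have i4 : d + 2 - 1 = d + 1 := by omega
  rw [i1, D.nest_eq] at hr₁
  rw [i2, D.nest_eq] at hr₂
  rw [hr₁.unique (D.first _)] at h1
  rw [hr₂.unique (D.first _)] at h2
  obtain ⟨k₁, k₂, τ, rfl, hKB⟩ := D.exists_isReturnBranch hf hK hc
  obtain ⟨m, s, x', y', x, y, hB', hsub, hs, hcomp, hx, hxy, hy, hcr1, hcr2, hrad⟩ :=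
    D.exists_deep_interval hf hrec hE hσ hcr hKB ht h1 h2
  have hx'y' : x' < y' := hB'.lt
  have hend : l (N + d + 1) ≤ x' ∧ y' ≤ u (N + d + 1) := by
    have := (Ioo_subset_Ioo_iff hx'y').1 (hsub.trans sdiff_subset)
    exact this
  have hlog : ∀ w₀ w₁ w₂ w₃, 0 < crossRatio w₀ w₁ w₂ w₃ := fun _ _ _ _ =>
    one_pos.trans_le (one_le_crossRatio _ _ _ _)
  have hq0 : 0 ≤ (E - 1) * σ ^ d := by positivity
  constructor
  · refine ⟨m, Ioo x' y', ⟨isOpen_Ioo, ordConnected_Ioo, hB'.bijOn hf,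
      fun w hw => hB'.deriv_ne_zero hf hw hKB.isBranch.subset⟩, ?_, Ioo x y, ?_, ?_, ?_, ?_⟩
    · rw [i1, i2, D.nest_eq, D.nest_eq]; exact hsub
    · refine ⟨s, ?_, ?_⟩
      · rw [i2, show N + d + 2 - 1 = N + d + 1 by omega, D.nest_eq]; exact hs
      · rw [i2, show N + d + 2 - 1 = N + d + 1 by omega, D.nest_eq, hcomp]
    · rw [closure_Ioo hxy.ne]
      exact Icc_subset_Ioo hx hy
    · rw [i1, D.nest_eq, poincareLength_Ioo (by linarith [hend.1]) hxy (by linarith [hend.2]),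
        poincareLength_Ioo hx hxy hy]
      exact Real.log_le_log (hlog _ _ _ _) hcr2
    · rw [poincareLength_Ioo hx hxy hy, i4]
      calc Real.log (crossRatio x' x y y') ≤ Real.log ((1 + (E - 1) * σ ^ d) ^ 2) :=
            Real.log_le_log (hlog _ _ _ _) hcr1
        _ = 2 * Real.log (1 + (E - 1) * σ ^ d) := by rw [Real.log_pow]; norm_num
        _ ≤ 2 * ((E - 1) * σ ^ d) := by
          have := Real.log_le_sub_one_of_pos (show 0 < 1 + (E - 1) * σ ^ d by linarith)
          linarith
        _ = C₁ * σ ^ (d + 1) := by rw [hC₁]; field_simp; ring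
        _ ≤ (C₁ + C₂) * σ ^ (d + 1) := by gcongr; linarith
  · rw [rpow_half_eq_sqrt hσ0.le (by omega), i4, i3]
    refine (D.scalingFactor_le hA (N + d + 2)).trans ?_
    change A ^ 2 * (radius f c l (N + d + 3) / radius f c l (N + d + 2)) ≤ _
    have p2 := hA.pos (N + d + 2)
    have p3 := hA.pos (N + d + 3)
    set ρ := radius f c l (N + d + 2)
    set ρ' := radius f c l (N + d + 3)
    have hlt : ρ' ^ 2 ≤ ρ ^ 2 := (D.sq_radius_lt hf (N + d + 2)).le
    have hσd : σ ^ d ≤ 1 := pow_le_one₀ hσ0.le hσ1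
    have hle : (1 + (E - 1) * σ ^ d) ^ 2 ≤ 1 + B * σ ^ d := by
      have : (E - 1) ^ 2 * σ ^ d * σ ^ d ≤ (E - 1) ^ 2 * σ ^ d * 1 := by gcongr
      rw [hB]; linarith
    have key : ρ' ^ 2 ≤ ρ ^ 2 * (B * σ ^ d) := by
      have h3 := mul_le_mul_of_nonneg_left ((hcr2.trans hcr1).trans hle) (sub_nonneg.2 hlt)
      have h4 : 0 ≤ ρ' ^ 2 * (B * σ ^ d) := by positivity
      linarith
    have hratio : ρ' / ρ ≤ √(B * σ ^ d) := by
      apply Real.le_sqrt_of_sq_le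
      rw [div_pow, div_le_iff₀ (by positivity)]
      linarith
    have hsq : √(B * σ ^ d) = √(B / σ) * √(σ ^ (d + 1)) := by
      rw [← Real.sqrt_mul (by positivity)]
      congr 1
      field_simp
      ring
    calc A ^ 2 * (ρ' / ρ) ≤ A ^ 2 * √(B * σ ^ d) := by gcongr
      _ = C₂ * √(σ ^ (d + 1)) := by rw [hsq, hC₂]; ring
      _ ≤ (C₁ + C₂) * √(σ ^ (d + 1)) := by gcongr; linarith

end NestData

end PrincipalNest

open PrincipalNest in
theorem lemma4p6 (f : ℝ → ℝ) (a b c p q : ℝ)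
    (hf : IsQuasiQuadratic f a b c)
    (hI : IsInitialInterval f a b c p q)
    (hrec : IsRecurrent f c)
    (hnc : NoCentralReturns f c (Set.Ioo p q)) :
    ((∃ δ : ℝ, 0 < δ ∧ ∀ n : ℕ, 1 ≤ n → δ ≤ scalingFactor f c (Set.Ioo p q) n) →
      ∃ N : ℕ, ∀ n : ℕ, 1 ≤ n → ∀ K ∈ levelIntervals f c (Set.Ioo p q) n,
        ∃ k : ℕ, k ≤ N ∧ HasRank f c (Set.Ioo p q) n K k) ∧
    (∀ lam : ℝ,
      (∀ n : ℕ, 1 ≤ n →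
        poincareLength (nest f c (Set.Ioo p q) n) (nest f c (Set.Ioo p q) (n - 1)) ≤ lam) →
      ∃ C : ℝ, ∀ n : ℕ, 1 ≤ n → ∀ K ∈ levelIntervals f c (Set.Ioo p q) n,
        ∀ k : ℕ, 2 ≤ k → HasRank f c (Set.Ioo p q) n K k →
          (∃ (m : ℕ) (K' : Set ℝ), IsMonotonePullback f m K' K ∧
            K' ⊆ nest f c (Set.Ioo p q) (n + k - 2) \ nest f c (Set.Ioo p q) (n + k - 1) ∧
            ∃ L ∈ levelIntervals f c (Set.Ioo p q) (n + k - 1), closure L ⊆ K' ∧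
              poincareLength L (nest f c (Set.Ioo p q) (n + k - 2)) ≤ poincareLength L K' ∧
              poincareLength L K' ≤ C * sigmaBar lam ^ (k - 1)) ∧
          scalingFactor f c (Set.Ioo p q) (n + k) ≤ C * sigmaBar lam ^ (((k : ℝ) - 1) / 2)) := by
  obtain ⟨l, u, r, D⟩ := exists_nestData hf hI hrec hnc
  have hnc' : ∀ n, f^[r n] c ∉ Ioo (l (n + 1)) (u (n + 1)) := by
    intro n
    rw [← D.nest_eq]
    exact hnc (n + 1) (by omega) _ (by rw [Nat.add_sub_cancel, D.nest_eq]; exact D.first n)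
  constructor
  · rintro ⟨δ, hδ, hμ⟩
    obtain ⟨A, hA⟩ := D.exists_comparable hf
    obtain ⟨B, hB⟩ := D.exists_crossRatio_le hf hA hnc'
    have hB0 : 0 < B := one_pos.trans_le ((one_le_crossRatio _ _ _ _).trans (hB 0))
    obtain ⟨C, hC⟩ := D.exists_rank_bound hf hrec (lam := Real.log B)
      (by rwa [Real.exp_log hB0])
    set σ := sigmaBar (Real.log B) with hσ
    have hσ0 : 0 < σ := by rw [hσ, sigmaBar]; positivity
    have hσ1 : σ < 1 := by
      rw [hσ, sigmaBar, div_lt_one (by positivity)]; linarith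
    have hlim : Tendsto (fun j : ℕ => C * √(σ ^ j)) atTop (nhds 0) := by
      have h1 := (tendsto_pow_atTop_nhds_zero_of_lt_one hσ0.le hσ1).sqrt
      rw [Real.sqrt_zero] at h1
      simpa using h1.const_mul C
    obtain ⟨N₀, hN₀⟩ := eventually_atTop.1 (hlim.eventually (gt_mem_nhds hδ))
    refine ⟨N₀ + 1, fun n hn K hK => ?_⟩
    obtain ⟨N, rfl⟩ : ∃ N, n = N + 1 := ⟨n - 1, by omega⟩
    obtain ⟨k, hk⟩ := D.exists_hasRank hK
    refine ⟨k, ?_, hk⟩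
    by_contra! hcon
    have h1 := (hC (N + 1) hn K hK k (by omega) hk).2
    rw [rpow_half_eq_sqrt hσ0.le (by omega)] at h1
    have h2 := hN₀ (k - 1) (by omega)
    have h3 := hμ (N + 1 + k) (by omega)
    linarith
  · intro lam hlam
    refine D.exists_rank_bound hf hrec fun n => ?_
    have h := hlam (n + 1) (by omega)
    rw [Nat.add_sub_cancel, D.nest_eq, D.nest_eq,
      poincareLength_Ioo (D.lt_left n) (D.lt _) (D.lt_right n)] at h
    exact (Real.log_le_iff_le_exp (one_pos.trans_le (one_le_crossRatio _ _ _ _))).1 h
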